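/- There are constants $C,\alpha>0$ and a randomized polynomial-time algorithm such that the following holds for all integers $m,n,k$ with $1\le k\le n$ and all real $p>0$. Put $$X=\frac{m\,k\,p\,\log m}{n},\qquad t=\max\Big\{0,\ \frac{\log X+\log\log m}{\log\log (X+\log m)}\Big\},$$ and suppose that $X+\log m>e$, so that the denominator is positive (this holds for all $m\ge 16$). Let $A$ be a random $m\times n$ matrix with entries in $\{0,1\}$ whose rows are independent, each row being uniformly distributed among the $0$-$1$ rows with exactly $k$ ones. Call $(c,x')$ admissible for $A$ if $c,x'\in\mathbb R^n$ satisfy $\frac1p\le c_i\le 1$ and $0\le x'_i\le 1$ for all $i$, and $(Ax')_j\le 1$ for $1\le j\le m$; write $\mathrm{OPT}=\sum_i c_ix'_i$. (1) With probability at least $1-\frac1m$ over $A$, for every admissible $(c,x')$ there is $\hat x\in\{0,1\}^n$ with $$\|A\hat x\|_\infty\le C\,t\qquad\text{and}\qquad \sum_i c_i\hat x_i\ \ge\ \alpha\cdot \mathrm{OPT}.$$ (2) Such an $\hat x$ is found by the algorithm: its running time on input $(A,c,x')$ with rational $c,x'$ is bounded, for all outcomes of its coin tosses, by a fixed polynomial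 in the bit length of the input; and if for every $A$ with exactly $k$ ones in each row a rational admissible pair $(c,x')=(c(A),x'(A))$ is given, then with probability at least $1-\frac1m$ over $A$ and the coin tosses of the algorithm, its output on $(A,c,x')$ is a vector $\hat x\in\{0,1\}^n$ with the two properties in (1). -/

import Mathlib

open MeasureTheory ProbabilityTheory Matrix

/-! ### The random matrix -/

/-- `0`-`1` matrices, stored as Boolean tables. -/
abbrev BoolMat (m n : ℕ) : Type := Fin m → Fin n → Bool

/-- The matrix with real entries `0`, `1`. -/
def BoolMat.toReal {m n : ℕ} (A : BoolMat m n) : Matrix (Fin m) (Fin n) ℝ :=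
  Matrix.of fun i j => if A i j then 1 else 0

/-- The rows of length `n` with exactly `k` ones. -/
def rowsWith (n k : ℕ) : Set (Fin n → Bool) :=
  {r | (Finset.univ.filter fun j => r j = true).card = k}

/-- The law of the random `m × n` matrix: the rows are independent, and each of them is uniformly
distributed on the `0`-`1` rows with exactly `k` ones. -/
noncomputable def randomMatrix (m n k : ℕ) : Measure (BoolMat m n) :=
  Measure.pi fun _ : Fin m => uniformOn (rowsWith n k)

/-! ### Feasible fractional points and good roundings -/

/-- The weights lie in `[1/p, 1]`, the point `x` lies in `[0,1]^n` and `A x ≤ 1`. -/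
def Feasible {m n : ℕ} (A : BoolMat m n) (p : ℝ) (c x : Fin n → ℝ) : Prop :=
  (∀ j, 1 / p ≤ c j ∧ c j ≤ 1) ∧ (∀ j, 0 ≤ x j ∧ x j ≤ 1) ∧ ∀ i, (A.toReal *ᵥ x) i ≤ 1

/-- The quantity `m k p log m / n`. -/
noncomputable def load (m n k : ℕ) (p : ℝ) : ℝ :=
  (m : ℝ) * k * p * Real.log m / n

/-- The positive part of
`(log (m k p log m / n) + log log m) / log log (m k p log m / n + log m)`. -/
noncomputable def errorBound (m n k : ℕ) (p : ℝ) : ℝ :=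
  max 0 ((Real.log (load m n k p) + Real.log (Real.log m)) /
    Real.log (Real.log (load m n k p + Real.log m)))

/-- `y` is a `0`-`1` vector with `‖A y‖_∞ ≤ e` (the norm of `Fin m → ℝ` is the maximum norm) and
with objective value at least `α` times that of `x`. -/
def IsGoodRounding {m n : ℕ} (A : BoolMat m n) (e α : ℝ) (c x y : Fin n → ℝ) : Prop :=
  (∀ j, y j = 0 ∨ y j = 1) ∧ ‖A.toReal *ᵥ y‖ ≤ e ∧ α * (c ⬝ᵥ x) ≤ c ⬝ᵥ y

/-! ### Randomized algorithms: a random access machine with logarithmic cost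

The memory consists of arrays of rational numbers; programs are built from assignments, coin
tosses, sequencing, branching and while-loops. Every evaluation of a subexpression is charged the
bit length of its value, so that running times agree, up to polynomials, with those of
(probabilistic) Turing machines. -/

/-- The bit length of a rational number. -/
def bitLength (q : ℚ) : ℕ := Nat.size q.num.natAbs + Nat.size q.den + 1

/-- `M a i` is cell `i` of array `a`. -/
abbrev Memory : Type := ℕ → ℕ → ℚ

/-- Arithmetic expressions. -/
inductive Expr : Type
  | const (q : ℚ)
  | get (a : ℕ) (i : Expr)
  | add (e f : Expr)
  | sub (e f : Expr)
  | mul (e f : Expr)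
  | div (e f : Expr)
  | lt (e f : Expr)

/-- The value of an expression; an index is rounded down to a natural number, and a comparison has
the value `1` or `0`. -/
def Expr.eval (M : Memory) : Expr → ℚ
  | .const q => q
  | .get a i => M a ⌊i.eval M⌋₊
  | .add e f => e.eval M + f.eval M
  | .sub e f => e.eval M - f.eval M
  | .mul e f => e.eval M * f.eval M
  | .div e f => e.eval M / f.eval M
  | .lt e f => if e.eval M < f.eval M then 1 else 0

/-- The cost of evaluating an expression: the bit lengths of the values of all subexpressions. -/
def Expr.cost (M : Memory) : Expr → ℕ
  | .const q => bitLength q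
  | .get a i => i.cost M + bitLength ((Expr.get a i).eval M)
  | .add e f => e.cost M + f.cost M + bitLength ((Expr.add e f).eval M)
  | .sub e f => e.cost M + f.cost M + bitLength ((Expr.sub e f).eval M)
  | .mul e f => e.cost M + f.cost M + bitLength ((Expr.mul e f).eval M)
  | .div e f => e.cost M + f.cost M + bitLength ((Expr.div e f).eval M)
  | .lt e f => e.cost M + f.cost M + bitLength ((Expr.lt e f).eval M)

/-- Programs. -/
inductive Prog : Type
  | skip
  | assign (a : ℕ) (i e : Expr)
  | toss (a : ℕ) (i : Expr)
  | seq (P Q : Prog)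
  | ite (b : Expr) (P Q : Prog)
  | while (b : Expr) (P : Prog)

/-- A configuration: the memory and the number of coins tossed so far. -/
structure Config : Type where
  mem : Memory
  used : ℕ

/-- Write `q` into cell `i` of array `a`. -/
def Memory.write (M : Memory) (a i : ℕ) (q : ℚ) : Memory :=
  fun a' i' => if a' = a ∧ i' = i then q else M a' i'

/-- `Run ω P s t s'`: with coin tosses `ω`, the program `P` started in `s` halts in `s'` after
`t` steps. -/
inductive Run (ω : ℕ → Bool) : Prog → Config → ℕ → Config → Prop
  | skip (s : Config) : Run ω .skip s 1 s
  | assign (a : ℕ) (i e : Expr) (s : Config) :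
      Run ω (.assign a i e) s (i.cost s.mem + e.cost s.mem + 1)
        ⟨Memory.write s.mem a ⌊i.eval s.mem⌋₊ (e.eval s.mem), s.used⟩
  | toss (a : ℕ) (i : Expr) (s : Config) :
      Run ω (.toss a i) s (i.cost s.mem + 1)
        ⟨Memory.write s.mem a ⌊i.eval s.mem⌋₊ (if ω s.used then 1 else 0), s.used + 1⟩
  | seq {P Q : Prog} {s₀ s₁ s₂ : Config} {t₁ t₂ : ℕ} :
      Run ω P s₀ t₁ s₁ → Run ω Q s₁ t₂ s₂ → Run ω (.seq P Q) s₀ (t₁ + t₂ + 1) s₂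
  | ite_pos {b : Expr} {P Q : Prog} {s s' : Config} {t : ℕ} :
      b.eval s.mem ≠ 0 → Run ω P s t s' → Run ω (.ite b P Q) s (b.cost s.mem + t + 1) s'
  | ite_neg {b : Expr} {P Q : Prog} {s s' : Config} {t : ℕ} :
      b.eval s.mem = 0 → Run ω Q s t s' → Run ω (.ite b P Q) s (b.cost s.mem + t + 1) s'
  | while_done {b : Expr} {P : Prog} {s : Config} :
      b.eval s.mem = 0 → Run ω (.while b P) s (b.cost s.mem + 1) s
  | while_step {b : Expr} {P : Prog} {s₀ s₁ s₂ : Config} {t₁ t₂ : ℕ} :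
      b.eval s₀.mem ≠ 0 → Run ω P s₀ t₁ s₁ → Run ω (.while b P) s₁ t₂ s₂ →
        Run ω (.while b P) s₀ (b.cost s₀.mem + t₁ + t₂ + 1) s₂

/-- The input `(A, c, x)`: array `0` holds `m` and `n`, array `1` holds `A` row by row, arrays `2`
and `3` hold `c` and `x`; everything else is `0`. -/
def inputMemory {m n : ℕ} (A : BoolMat m n) (c x : Fin n → ℚ) : Memory := fun a l =>
  match a with
  | 0 => if l = 0 then (m : ℚ) else if l = 1 then (n : ℚ) else 0
  | 1 => if h : l < m * n then
      (if A (finProdFinEquiv.symm ⟨l, h⟩).1 (finProdFinEquiv.symm ⟨l, h⟩).2 then 1 else 0) else 0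
  | 2 => if h : l < n then c ⟨l, h⟩ else 0
  | 3 => if h : l < n then x ⟨l, h⟩ else 0
  | _ => 0

/-- The length of the input `(A, c, x)`. -/
def inputLength {m n : ℕ} (_A : BoolMat m n) (c x : Fin n → ℚ) : ℕ :=
  m + n + m * n + ∑ j, bitLength (c j) + ∑ j, bitLength (x j)

/-- On the input `(A, c, x)` and with coin tosses `ω`, the program `P` halts after `t` steps, with
the vector `y` in array `4`. -/
def Outputs {m n : ℕ} (P : Prog) (ω : ℕ → Bool) (A : BoolMat m n) (c x : Fin n → ℚ)
    (t : ℕ) (y : Fin n → ℚ) : Prop :=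
  ∃ s : Config, Run ω P ⟨inputMemory A c x, 0⟩ t s ∧ ∀ j : Fin n, s.mem 4 j = y j

/-- There is a polynomial in the input length that bounds the running time of `P` on all inputs and
for all coin tosses. -/
def RunsInPolyTime (P : Prog) : Prop :=
  ∃ q : Polynomial ℕ, ∀ (m n : ℕ) (A : BoolMat m n) (c x : Fin n → ℚ) (ω : ℕ → Bool),
    ∃ (t : ℕ) (y : Fin n → ℚ), Outputs P ω A c x t y ∧ t ≤ q.eval (inputLength A c x)

/-- Independent fair coin tosses. -/
noncomputable def fairCoins : Measure (ℕ → Bool) :=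
  Measure.infinitePi fun _ : ℕ => uniformOn (Set.univ : Set Bool)

/-! The rounding exists for every matrix with `k` ones in each row, and a deterministic procedure
finds it, so both events contain an event of probability one. Mixing `x` with the constant vector `1
/ k` gives a start point `z` that still satisfies `A z ≤ 1`. Its value `v` is at least half of the
optimum and, because `c ≥ 1 / p`, at least `n / (2 k p)`. Let `s` be least with `2 m / v ≤ 2 ^ s`;
then `2 ^ s < 8 m k p / n` unless `s = 0`.

Coordinates are rounded greedily, in the manner of conditional expectations. From the objective
subtract, for each row, the penalty `(∏ (1 + s a z) - 1) / (s 16 ^ s)`. This function is affine in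
each coordinate, and `roundSeq` moves each coordinate to the end that does not decrease it
(`penalizedValue_roundSeq_mono`). At the start the penalties total at most `m (e / 16) ^ s ≤ v / 2`,
so at least `v / 2` survives (`value_le_two_mul_roundSeq`). When a column is chosen, each row
containing it has weight below `16 ^ s`, whereas every earlier chosen column in that row contributes
a factor `s + 1`. Hence a nonzero load `N` satisfies `(s + 1) ^ (N - 1) < 16 ^ s`
(`rowLoad_roundSeq`), which means `N = O(s / log (s + 1))`; `load_le_errorBound` compares this with
the error bound by elementary estimates.

For the running time, `HaltsWith` combines correctness with a bound polynomial in the height of the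
memory contents and the number of loop passes. Both are polynomial in the input length
(`haltsWith_program`), for feasible and infeasible inputs alike. -/

/-! ### Heights of rational numbers -/

/-- `q` has absolute value and denominator at most `2 ^ h`. Unlike `bitLength`, such bounds simply
add up under sums and products. -/
structure HtLe (q : ℚ) (h : ℕ) : Prop where
  one_le : 1 ≤ h
  abs_le : |q| ≤ 2 ^ h
  den_le : q.den ≤ 2 ^ h

namespace HtLe

variable {q r : ℚ} {g h : ℕ}

theorem mono (hq : HtLe q g) (hgh : g ≤ h) : HtLe q h where
  one_le := hq.one_le.trans hgh
  abs_le := hq.abs_le.trans (pow_le_pow_right₀ (by norm_num) hgh)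
  den_le := hq.den_le.trans (Nat.pow_le_pow_right (by norm_num) hgh)

theorem neg (hq : HtLe q h) : HtLe (-q) h where
  one_le := hq.one_le
  abs_le := by simpa using hq.abs_le
  den_le := by simpa using hq.den_le

theorem add (hq : HtLe q g) (hr : HtLe r h) : HtLe (q + r) (g + h) where
  one_le := le_add_right hq.one_le
  abs_le := by
    have h1 := hq.abs_le
    have h2 := hr.abs_le
    -- Heights at least `1` make both powers at least `2`, so that their sum is at most their
    -- product.
    have h3 : (2 : ℚ) ≤ 2 ^ g := by
      simpa using pow_le_pow_right₀ (a := (2 : ℚ)) (by norm_num) hq.one_le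
    have h4 : (2 : ℚ) ≤ 2 ^ h := by
      simpa using pow_le_pow_right₀ (a := (2 : ℚ)) (by norm_num) hr.one_le
    rw [pow_add]
    refine (abs_add_le q r).trans ?_
    nlinarith
  den_le := by
    rw [pow_add]
    exact (Nat.le_of_dvd (Nat.mul_pos q.den_pos r.den_pos) (Rat.add_den_dvd q r)).trans
      (Nat.mul_le_mul hq.den_le hr.den_le)

theorem sub (hq : HtLe q g) (hr : HtLe r h) : HtLe (q - r) (g + h) := by
  simpa [sub_eq_add_neg] using hq.add hr.neg

theorem mul (hq : HtLe q g) (hr : HtLe r h) : HtLe (q * r) (g + h) where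
  one_le := le_add_right hq.one_le
  abs_le := by
    rw [pow_add, abs_mul]
    exact mul_le_mul hq.abs_le hr.abs_le (abs_nonneg _) (by positivity)
  den_le := by
    rw [pow_add]
    exact (Nat.le_of_dvd (Nat.mul_pos q.den_pos r.den_pos) (Rat.mul_den_dvd q r)).trans
      (Nat.mul_le_mul hq.den_le hr.den_le)

theorem natCast {n : ℕ} (hh : 1 ≤ h) (hn : n ≤ 2 ^ h) : HtLe (n : ℚ) h where
  one_le := hh
  abs_le := by
    rw [Nat.abs_cast]
    exact_mod_cast hn
  den_le := by simpa using Nat.one_le_two_pow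

theorem zero (hh : 1 ≤ h) : HtLe 0 h := by
  simpa using natCast (n := 0) hh (Nat.zero_le _)

theorem one (hh : 1 ≤ h) : HtLe 1 h := by
  simpa using natCast (n := 1) hh Nat.one_le_two_pow

theorem num_le (hq : HtLe q h) : q.num.natAbs ≤ 2 ^ (2 * h) := by
  have h1 : ((q.num.natAbs : ℕ) : ℚ) = |q| * q.den := by
    rw [Nat.cast_natAbs, Int.cast_abs]
    conv_lhs => rw [← Rat.mul_den_eq_num q]
    rw [abs_mul, Nat.abs_cast]
  have h2 : ((q.num.natAbs : ℕ) : ℚ) ≤ 2 ^ h * 2 ^ h := by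
    rw [h1]
    exact mul_le_mul hq.abs_le (by exact_mod_cast hq.den_le) (by positivity) (by positivity)
  rw [two_mul, pow_add]
  exact_mod_cast h2

/-- A nonzero numerator has absolute value at least `1`, so `|q⁻¹|` is at most the denominator of
`q`. The denominator of `q⁻¹` is `|q|` times the denominator of `q`, which is why the height
doubles. -/
theorem inv (hq : HtLe q h) : HtLe q⁻¹ (2 * h) := by
  rcases eq_or_ne q 0 with rfl | h0
  · simpa using zero (by have := hq.one_le; omega)
  have hn : q.num ≠ 0 := Rat.num_ne_zero.mpr h0
  refine ⟨by have := hq.one_le; omega, ?_, ?_⟩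
  · have h1 : |q⁻¹| ≤ q.den := by
      rw [abs_inv]
      have h2 : (1 : ℚ) ≤ |q| * q.den := by
        rw [← Nat.abs_cast q.den, ← abs_mul, Rat.mul_den_eq_num]
        exact_mod_cast Int.one_le_abs hn
      rw [inv_le_iff_one_le_mul₀ (abs_pos.mpr h0)]
      linarith
    refine h1.trans ?_
    have : (q.den : ℚ) ≤ 2 ^ h := by exact_mod_cast hq.den_le
    exact this.trans (pow_le_pow_right₀ (by norm_num) (by omega))
  · rw [Rat.den_inv_of_ne_zero h0]
    exact hq.num_le

theorem div (hq : HtLe q g) (hr : HtLe r h) : HtLe (q / r) (g + 2 * h) := by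
  simpa [div_eq_mul_inv] using hq.mul hr.inv

theorem ite_one_zero {p : Prop} [Decidable p] (hh : 1 ≤ h) : HtLe (if p then 1 else 0) h := by
  split_ifs
  exacts [one hh, zero hh]

theorem pow (hq : HtLe q h) (n : ℕ) : HtLe (q ^ n) ((n + 1) * h) := by
  induction n with
  | zero => simpa using one hq.one_le
  | succ n ih =>
    rw [pow_succ]
    exact (ih.mul hq).mono (by ring_nf; omega)

theorem sum_range {f : ℕ → ℚ} {n : ℕ} (hh : 1 ≤ h) (hf : ∀ i < n, HtLe (f i) h) :
    HtLe (∑ i ∈ Finset.range n, f i) ((n + 1) * h) := by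
  induction n with
  | zero => simpa using zero hh
  | succ n ih =>
    rw [Finset.sum_range_succ]
    exact ((ih fun i hi => hf i (by omega)).add (hf n (by omega))).mono (by ring_nf; omega)

theorem prod_range {f : ℕ → ℚ} {n : ℕ} (hh : 1 ≤ h) (hf : ∀ i < n, HtLe (f i) h) :
    HtLe (∏ i ∈ Finset.range n, f i) ((n + 1) * h) := by
  induction n with
  | zero => simpa using one hh
  | succ n ih =>
    rw [Finset.prod_range_succ]
    exact ((ih fun i hi => hf i (by omega)).mul (hf n (by omega))).mono (by ring_nf; omega)

theorem of_bitLength_le (hq : bitLength q ≤ h) : HtLe q h := by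
  unfold bitLength at hq
  have h1 : q.num.natAbs ≤ 2 ^ h :=
    (Nat.lt_size_self _).le.trans (Nat.pow_le_pow_right (by norm_num) (by omega))
  have h2 : q.den ≤ 2 ^ h :=
    (Nat.lt_size_self _).le.trans (Nat.pow_le_pow_right (by norm_num) (by omega))
  refine ⟨by omega, ?_, h2⟩
  have h3 : |q| ≤ (q.num.natAbs : ℕ) := by
    have h4 : (1 : ℚ) ≤ q.den := by exact_mod_cast q.den_pos
    have h5 : ((q.num.natAbs : ℕ) : ℚ) = |q| * q.den := by
      rw [Nat.cast_natAbs, Int.cast_abs]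
      conv_lhs => rw [← Rat.mul_den_eq_num q]
      rw [abs_mul, Nat.abs_cast]
    rw [h5]
    exact le_mul_of_one_le_right (abs_nonneg q) h4
  exact h3.trans (by exact_mod_cast h1)

theorem bitLength_le (hq : HtLe q h) : bitLength q ≤ 6 * h := by
  have h1 : Nat.size q.num.natAbs ≤ 2 * h + 1 := by
    rw [Nat.size_le]
    exact hq.num_le.trans_lt (Nat.pow_lt_pow_right (by norm_num) (by omega))
  have h2 : Nat.size q.den ≤ h + 1 := by
    rw [Nat.size_le]
    exact hq.den_le.trans_lt (Nat.pow_lt_pow_right (by norm_num) (by omega))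
  have := hq.one_le
  unfold bitLength
  omega

end HtLe

/-! ### Running times of programs with bounded memory contents -/

/-- If all memory cells have height at most `h`, then the value of the expression has height at
most `e.htFactor * h`. -/
def Expr.htFactor : Expr → ℕ
  | .const q => bitLength q
  | .get _ _ => 1
  | .add e f => e.htFactor + f.htFactor
  | .sub e f => e.htFactor + f.htFactor
  | .mul e f => e.htFactor + f.htFactor
  | .div e f => e.htFactor + 2 * f.htFactor
  | .lt _ _ => 1

/-- If all memory cells have height at most `h`, then the cost of the expression is at
most `e.costFactor * h`. -/
def Expr.costFactor : Expr → ℕ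
  | .const q => 6 * bitLength q
  | .get _ i => i.costFactor + 6
  | .add e f => e.costFactor + f.costFactor + 6 * (e.htFactor + f.htFactor)
  | .sub e f => e.costFactor + f.costFactor + 6 * (e.htFactor + f.htFactor)
  | .mul e f => e.costFactor + f.costFactor + 6 * (e.htFactor + f.htFactor)
  | .div e f => e.costFactor + f.costFactor + 6 * (e.htFactor + 2 * f.htFactor)
  | .lt e f => e.costFactor + f.costFactor + 6

theorem Expr.htLe_eval {M : Memory} {h : ℕ} (hh : 1 ≤ h) (hM : ∀ a l, HtLe (M a l) h) (e : Expr) :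
    HtLe (e.eval M) (e.htFactor * h) := by
  induction e with
  | const q =>
    exact (HtLe.of_bitLength_le le_rfl).mono (Nat.le_mul_of_pos_right _ hh)
  | get a i => simpa [Expr.htFactor, Expr.eval] using hM a _
  | add e f he hf => exact (he.add hf).mono (by simp [Expr.htFactor, add_mul])
  | sub e f he hf => exact (he.sub hf).mono (by simp [Expr.htFactor, add_mul])
  | mul e f he hf => exact (he.mul hf).mono (by simp [Expr.htFactor, add_mul])
  | div e f he hf => exact (he.div hf).mono (by simp [Expr.htFactor, add_mul, mul_assoc])
  | lt e f he hf => exact HtLe.ite_one_zero (by simpa [Expr.htFactor] using hh)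

theorem Expr.cost_le {M : Memory} {h : ℕ} (hh : 1 ≤ h) (hM : ∀ a l, HtLe (M a l) h) (e : Expr) :
    e.cost M ≤ e.costFactor * h := by
  have key := fun e => (Expr.htLe_eval hh hM e).bitLength_le
  induction e with
  | const q =>
    have := key (.const q)
    simp only [Expr.cost, Expr.costFactor]
    exact (Nat.le_mul_of_pos_left _ (by norm_num)).trans (Nat.le_mul_of_pos_right _ hh)
  | get a i hi =>
    have := key (.get a i)
    simp only [Expr.cost, Expr.costFactor, Expr.htFactor] at *
    linarith
  | add e f he hf =>
    have := key (.add e f)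
    simp only [Expr.cost, Expr.costFactor, Expr.htFactor] at *
    linarith
  | sub e f he hf =>
    have := key (.sub e f)
    simp only [Expr.cost, Expr.costFactor, Expr.htFactor] at *
    linarith
  | mul e f he hf =>
    have := key (.mul e f)
    simp only [Expr.cost, Expr.costFactor, Expr.htFactor] at *
    linarith
  | div e f he hf =>
    have := key (.div e f)
    simp only [Expr.cost, Expr.costFactor, Expr.htFactor] at *
    linarith
  | lt e f he hf =>
    have := key (.lt e f)
    simp only [Expr.cost, Expr.costFactor, Expr.htFactor] at *
    linarith

/-- The total size of the code, expressions being weighted by their cost factors. -/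
def Prog.weight : Prog → ℕ
  | .skip => 1
  | .assign _ i e => i.costFactor + e.costFactor + 1
  | .toss _ i => i.costFactor + 1
  | .seq P Q => P.weight + Q.weight + 1
  | .ite b P Q => b.costFactor + P.weight + Q.weight + 1
  | .while b P => b.costFactor + P.weight + 1

/-- The nesting depth of the loops. -/
def Prog.depth : Prog → ℕ
  | .skip => 0
  | .assign _ _ _ => 0
  | .toss _ _ => 0
  | .seq P Q => max P.depth Q.depth
  | .ite _ P Q => max P.depth Q.depth
  | .while _ P => P.depth + 1

/-- Started with memory `M`, the program halts with a memory satisfying `post`, uses no coins, and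
its running time is that of a program with memory contents of height at most `h` each of whose
loops is passed through less than `r` times. -/
def HaltsWith (h r : ℕ) (P : Prog) (M : Memory) (post : Memory → Prop) : Prop :=
  ∀ (ω : ℕ → Bool) (u : ℕ), ∃ (t : ℕ) (M' : Memory),
    Run ω P ⟨M, u⟩ t ⟨M', u⟩ ∧ t ≤ P.weight * h * r ^ P.depth ∧ post M'

namespace HaltsWith

variable {h r : ℕ} {P Q : Prog} {M : Memory} {mid post : Memory → Prop}

theorem assign {a : ℕ} {i e : Expr} (hh : 1 ≤ h) (hM : ∀ a l, HtLe (M a l) h)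
    (hpost : post (Memory.write M a ⌊i.eval M⌋₊ (e.eval M))) :
    HaltsWith h r (.assign a i e) M post := by
  intro ω u
  refine ⟨_, _, Run.assign a i e ⟨M, u⟩, ?_, hpost⟩
  have h1 := i.cost_le hh hM
  have h2 := e.cost_le hh hM
  simp only [Prog.weight, Prog.depth, pow_zero, mul_one]
  linarith

theorem seq (hr : 1 ≤ r) (hh : 1 ≤ h) (hP : HaltsWith h r P M mid)
    (hQ : ∀ M', mid M' → HaltsWith h r Q M' post) : HaltsWith h r (.seq P Q) M post := by
  intro ω u
  obtain ⟨t₁, M₁, hrun₁, ht₁, hmid⟩ := hP ω u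
  obtain ⟨t₂, M₂, hrun₂, ht₂, hpost⟩ := hQ M₁ hmid ω u
  refine ⟨_, M₂, Run.seq hrun₁ hrun₂, ?_, hpost⟩
  have h1 : r ^ P.depth ≤ r ^ max P.depth Q.depth := Nat.pow_le_pow_right hr (le_max_left _ _)
  have h2 : r ^ Q.depth ≤ r ^ max P.depth Q.depth := Nat.pow_le_pow_right hr (le_max_right _ _)
  have h3 : 1 ≤ h * r ^ max P.depth Q.depth := Nat.mul_pos hh (Nat.pow_pos hr)
  have h4 := Nat.mul_le_mul_left (P.weight * h) h1
  have h5 := Nat.mul_le_mul_left (Q.weight * h) h2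
  simp only [Prog.weight, Prog.depth]
  linarith

/-- The invariant is indexed by the number of passes and must itself bound all heights by the same
`h`; this excludes growth by repeated squaring and gives every pass the same cost bound. The guard
is evaluated `N + 1` times, hence `N + 1 ≤ r`. -/
theorem loop {b : Expr} {N : ℕ} (inv : ℕ → Memory → Prop) (hNr : N + 1 ≤ r) (hh : 1 ≤ h)
    (hM : ∀ i M, inv i M → ∀ a l, HtLe (M a l) h)
    (hstep : ∀ i < N, ∀ M, inv i M → b.eval M ≠ 0 ∧ HaltsWith h r P M (inv (i + 1)))
    (hend : ∀ M, inv N M → b.eval M = 0) (h0 : inv 0 M) :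
    HaltsWith h r (.while b P) M (inv N) := by
  have key : ∀ d i, i + d = N → ∀ M, inv i M → ∀ (ω : ℕ → Bool) (u : ℕ), ∃ (t : ℕ) (M' : Memory),
      Run ω (.while b P) ⟨M, u⟩ t ⟨M', u⟩ ∧
        t ≤ (d + 1) * (b.costFactor * h + P.weight * h * r ^ P.depth + 1) ∧ inv N M' := by
    intro d
    induction d with
    | zero =>
      intro i hi M hinv ω u
      obtain rfl : i = N := by omega
      refine ⟨_, M, Run.while_done (hend M hinv), ?_, hinv⟩
      have := b.cost_le hh (hM _ M hinv)
      simp only [zero_add, one_mul]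
      exact Nat.add_le_add_right (this.trans (Nat.le_add_right _ _)) 1
    | succ d ih =>
      intro i hi M hinv ω u
      obtain ⟨hb, hP⟩ := hstep i (by omega) M hinv
      obtain ⟨t₁, M₁, hrun₁, ht₁, hinv₁⟩ := hP ω u
      obtain ⟨t₂, M₂, hrun₂, ht₂, hinv₂⟩ := ih (i + 1) (by omega) M₁ hinv₁ ω u
      refine ⟨_, M₂, Run.while_step hb hrun₁ hrun₂, ?_, hinv₂⟩
      have := b.cost_le hh (hM _ M hinv)
      simp only at *
      rw [add_mul (d + 1) 1]
      linarith
  intro ω u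
  obtain ⟨t, M', hrun, ht, hinv⟩ := key N 0 (by omega) M h0 ω u
  refine ⟨t, M', hrun, ht.trans ?_, hinv⟩
  have hr : 1 ≤ r := by omega
  have h1 : 1 ≤ r ^ P.depth := Nat.pow_pos hr
  have h2 : b.costFactor * h ≤ b.costFactor * h * r ^ P.depth := Nat.le_mul_of_pos_right _ h1
  have h3 : 1 ≤ h * r ^ P.depth := Nat.mul_pos hh h1
  simp only [Prog.weight, Prog.depth]
  calc (N + 1) * (b.costFactor * h + P.weight * h * r ^ P.depth + 1)
      ≤ r * ((b.costFactor + P.weight + 1) * h * r ^ P.depth) :=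
        Nat.mul_le_mul hNr (by linarith)
    _ = _ := by ring

theorem mono {post' : Memory → Prop} (hP : HaltsWith h r P M post)
    (himp : ∀ M', post M' → post' M') : HaltsWith h r P M post' := by
  intro ω u
  obtain ⟨t, M', hrun, ht, hp⟩ := hP ω u
  exact ⟨t, M', hrun, ht, himp M' hp⟩

end HaltsWith

/-! ### The rounding procedure

Coordinates are rounded one after the other. The matrix `a` and the vectors are indexed by natural
numbers; only the first `m` rows and `n` columns matter. -/

section Rounding

open Finset

section Field

variable {K : Type*} [Field K]

/-- The exponential weight of row `j` at the point `z`. -/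
def rowWeight (a : ℕ → ℕ → K) (n s : ℕ) (z : ℕ → K) (j : ℕ) : K :=
  ∏ l ∈ range n, (1 + s * (a j l * z l))

/-- The total weight of the rows that contain column `i`. -/
def congestion (a : ℕ → ℕ → K) (m n s : ℕ) (z : ℕ → K) (i : ℕ) : K :=
  ∑ j ∈ range m, a j i * rowWeight a n s z j

/-- The point after the first coordinates have been rounded: a coordinate becomes `1` if its weight
outbids the congestion of its column. -/
def roundSeq [LinearOrder K] (a : ℕ → ℕ → K) (c : ℕ → K) (m n s : ℕ) (z : ℕ → K) : ℕ → ℕ → K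
  | 0 => z
  | i + 1 => Function.update (roundSeq a c m n s z i) i
      (if congestion a m n s (Function.update (roundSeq a c m n s z i) i 0) i < c i * 16 ^ s
        then 1 else 0)

end Field

/-- The program works over `ℚ` and the analysis over `ℝ`. The embedding respects the arithmetic and
the order, so every threshold test has the same outcome in both fields. -/
theorem ratCast_roundSeq (a : ℕ → ℕ → ℚ) (c : ℕ → ℚ) (m n s : ℕ) (z : ℕ → ℚ) (i l : ℕ) :
    ((roundSeq a c m n s z i l : ℚ) : ℝ) =
      roundSeq (fun j l => (a j l : ℝ)) (fun l => (c l : ℝ)) m n s (fun l => (z l : ℝ)) i l := by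
  induction i generalizing l with
  | zero => rfl
  | succ i ih =>
    have h1 : ∀ l, ((Function.update (roundSeq a c m n s z i) i 0 l : ℚ) : ℝ) =
        Function.update (roundSeq (fun j l => (a j l : ℝ)) (fun l => (c l : ℝ)) m n s
          (fun l => (z l : ℝ)) i) i 0 l := by
      intro l
      rcases eq_or_ne l i with rfl | hl
      · simp
      · simp [hl, ih]
    have h2 : ((congestion a m n s (Function.update (roundSeq a c m n s z i) i 0) i : ℚ) : ℝ) =
        congestion (fun j l => (a j l : ℝ)) m n s (Function.update (roundSeq
          (fun j l => (a j l : ℝ)) (fun l => (c l : ℝ)) m n s (fun l => (z l : ℝ)) i) i 0) i := by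
      simp only [congestion, rowWeight, ← h1]
      push_cast
      rfl
    rcases eq_or_ne l i with rfl | hl
    · simp only [roundSeq, Function.update_self, ← h2]
      have h3 : ((c l : ℝ) * 16 ^ s) = ((c l * 16 ^ s : ℚ) : ℝ) := by push_cast; rfl
      rw [h3]
      simp only [Rat.cast_lt]
      split_ifs <;> simp
    · simp [roundSeq, hl, ih]

/-! ### Value and row loads of the rounded point -/

variable {a : ℕ → ℕ → ℝ} {c z : ℕ → ℝ} {m n s : ℕ}

theorem roundSeq_of_le {i l : ℕ} (h : i ≤ l) : roundSeq a c m n s z i l = z l := by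
  induction i with
  | zero => rfl
  | succ i ih => rw [roundSeq, Function.update_of_ne (by omega), ih (by omega)]

theorem roundSeq_of_lt {i l : ℕ} (h : l < i) :
    roundSeq a c m n s z i l = roundSeq a c m n s z (l + 1) l := by
  induction i with
  | zero => omega
  | succ i ih =>
    rcases eq_or_ne l i with rfl | hl
    · rfl
    · rw [roundSeq, Function.update_of_ne hl, ih (by omega)]

theorem roundSeq_eq_zero_or_one {i l : ℕ} (h : l < i) :
    roundSeq a c m n s z i l = 0 ∨ roundSeq a c m n s z i l = 1 := by
  rw [roundSeq_of_lt h, roundSeq, Function.update_self]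
  split_ifs <;> simp

theorem roundSeq_mem (hz : ∀ l, 0 ≤ z l ∧ z l ≤ 1) (i l : ℕ) :
    0 ≤ roundSeq a c m n s z i l ∧ roundSeq a c m n s z i l ≤ 1 := by
  rcases lt_or_ge l i with h | h
  · rcases roundSeq_eq_zero_or_one (a := a) (c := c) (m := m) (n := n) (s := s) (z := z) h with
      h | h <;> simp [h]
  · rw [roundSeq_of_le h]
    exact hz l

/-- The primitive of the row weight: its partial derivative with respect to `z i` is the product
of `a i` and of the remaining factors `1 + s * a l * z l`. -/
noncomputable def rowPotential (r : ℕ → ℝ) (n s : ℕ) (z : ℕ → ℝ) : ℝ :=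
  if s = 0 then ∑ l ∈ range n, r l * z l else (∏ l ∈ range n, (1 + s * (r l * z l)) - 1) / s

/-- The potential is affine in each coordinate. Setting `z i` to `0` turns the `i`-th factor into
`1`, so the full product equals the product over the other columns. The linear form used for `s = 0`
is the limit of the quotient. -/
theorem rowPotential_eq {r : ℕ → ℝ} {i : ℕ} (hi : i < n) (z : ℕ → ℝ) :
    rowPotential r n s z = rowPotential r n s (Function.update z i 0) +
      z i * (r i * ∏ l ∈ range n, (1 + s * (r l * Function.update z i 0 l))) := by
  have hmem : i ∈ range n := mem_range.mpr hi
  have hne : ∀ l ∈ range n \ {i}, Function.update z i 0 l = z l := by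
    intro l hl
    rw [mem_sdiff, mem_singleton] at hl
    exact Function.update_of_ne hl.2 _ _
  unfold rowPotential
  split_ifs with hs
  · rw [sum_eq_add_sum_sdiff_singleton_of_mem hmem,
      sum_eq_add_sum_sdiff_singleton_of_mem hmem (fun l => r l * Function.update z i 0 l),
      sum_congr rfl fun l hl => by rw [← hne l hl]]
    simp [hs]
    ring
  · have hs' : (s : ℝ) ≠ 0 := by exact_mod_cast hs
    rw [prod_eq_mul_prod_sdiff_singleton_of_mem hmem,
      prod_eq_mul_prod_sdiff_singleton_of_mem hmem
        (fun l => 1 + (s : ℝ) * (r l * Function.update z i 0 l)),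
      prod_congr rfl fun l hl => by rw [← hne l hl]]
    simp
    field_simp
    ring

theorem rowPotential_nonneg {r : ℕ → ℝ} (hr : ∀ l, 0 ≤ r l) (hz : ∀ l, 0 ≤ z l) :
    0 ≤ rowPotential r n s z := by
  unfold rowPotential
  split_ifs
  · exact sum_nonneg fun l _ => mul_nonneg (hr l) (hz l)
  · refine div_nonneg (sub_nonneg.mpr ?_) (Nat.cast_nonneg s)
    refine Finset.one_le_prod fun l _ => ?_
    have := mul_nonneg (hr l) (hz l)
    have : 0 ≤ (s : ℝ) * (r l * z l) := by positivity
    linarith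

theorem rowPotential_le {r : ℕ → ℝ} (hr : ∀ l, 0 ≤ r l) (hz : ∀ l, 0 ≤ z l)
    (h : ∑ l ∈ range n, r l * z l ≤ 1) : rowPotential r n s z ≤ Real.exp s := by
  unfold rowPotential
  split_ifs with hs
  · exact h.trans (Real.one_le_exp (Nat.cast_nonneg s))
  · have hs' : (1 : ℝ) ≤ s := by exact_mod_cast Nat.one_le_iff_ne_zero.mpr hs
    have h1 : ∏ l ∈ range n, (1 + s * (r l * z l)) ≤ Real.exp s := by
      calc ∏ l ∈ range n, (1 + s * (r l * z l))
          ≤ ∏ l ∈ range n, Real.exp (s * (r l * z l)) := by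
            refine prod_le_prod (fun l _ => ?_) fun l _ => ?_
            · have := mul_nonneg (hr l) (hz l)
              positivity
            · rw [add_comm]
              exact Real.add_one_le_exp _
        _ = Real.exp (s * ∑ l ∈ range n, r l * z l) := by rw [← Real.exp_sum, mul_sum]
        _ ≤ Real.exp s := Real.exp_le_exp.mpr (mul_le_of_le_one_right (by positivity) h)
    rw [div_le_iff₀ (by linarith)]
    nlinarith [Real.exp_pos s]

/-- The objective value minus the penalties of the rows. -/
noncomputable def penalizedValue (a : ℕ → ℕ → ℝ) (c : ℕ → ℝ) (m n s : ℕ) (z : ℕ → ℝ) : ℝ :=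
  ∑ l ∈ range n, c l * z l - (∑ j ∈ range m, rowPotential (a j) n s z) / 16 ^ s

/-- The slope in coordinate `i` is positive exactly when the threshold test of `roundSeq` succeeds.
-/
theorem penalizedValue_eq {i : ℕ} (hi : i < n) (z : ℕ → ℝ) :
    penalizedValue a c m n s z = penalizedValue a c m n s (Function.update z i 0) +
      z i * (c i - congestion a m n s (Function.update z i 0) i / 16 ^ s) := by
  have hmem : i ∈ range n := mem_range.mpr hi
  have h1 : ∑ l ∈ range n, c l * z l =
      ∑ l ∈ range n, c l * Function.update z i 0 l + z i * c i := by
    rw [sum_eq_add_sum_sdiff_singleton_of_mem hmem,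
      sum_eq_add_sum_sdiff_singleton_of_mem hmem (fun l => c l * Function.update z i 0 l)]
    rw [sum_congr rfl fun l hl => by
      rw [← Function.update_of_ne (mem_singleton.not.mp (mem_sdiff.mp hl).2) 0 z]]
    simp
    ring
  have h2 : ∑ j ∈ range m, rowPotential (a j) n s z =
      ∑ j ∈ range m, rowPotential (a j) n s (Function.update z i 0) +
        z i * congestion a m n s (Function.update z i 0) i := by
    rw [congestion, mul_sum, ← sum_add_distrib]
    exact sum_congr rfl fun j _ => rowPotential_eq hi z
  rw [penalizedValue, penalizedValue, h1, h2]
  ring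

theorem penalizedValue_roundSeq_mono (hz : ∀ l, 0 ≤ z l ∧ z l ≤ 1) {i : ℕ} (hi : i ≤ n) :
    penalizedValue a c m n s z ≤ penalizedValue a c m n s (roundSeq a c m n s z i) := by
  induction i with
  | zero => rfl
  | succ i ih =>
    refine (ih (by omega)).trans ?_
    rw [penalizedValue_eq (i := i) (by omega),
      penalizedValue_eq (i := i) (by omega) (roundSeq a c m n s z (i + 1))]
    have hu : Function.update (roundSeq a c m n s z (i + 1)) i 0 =
        Function.update (roundSeq a c m n s z i) i 0 := by
      rw [roundSeq, Function.update_idem]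
    rw [hu, roundSeq_of_le le_rfl, roundSeq, Function.update_self]
    have hD : (0 : ℝ) < 16 ^ s := by positivity
    split_ifs with hlt
    · rw [← div_lt_iff₀ hD] at hlt
      nlinarith [hz i]
    · rw [not_lt, ← le_div_iff₀ hD] at hlt
      nlinarith [hz i]

/-- The rounded point keeps half of the objective value. -/
theorem value_le_two_mul_roundSeq (ha : ∀ j l, 0 ≤ a j l) (hz : ∀ l, 0 ≤ z l ∧ z l ≤ 1)
    (haz : ∀ j < m, ∑ l ∈ range n, a j l * z l ≤ 1)
    (hs : 2 * (m : ℝ) ≤ 2 ^ s * ∑ l ∈ range n, c l * z l) :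
    ∑ l ∈ range n, c l * z l ≤ 2 * ∑ l ∈ range n, c l * roundSeq a c m n s z n l := by
  have h1 := penalizedValue_roundSeq_mono (a := a) (c := c) (m := m) (s := s) hz le_rfl (n := n)
  have hD : (0 : ℝ) < 16 ^ s := by positivity
  have h2 : penalizedValue a c m n s (roundSeq a c m n s z n) ≤
      ∑ l ∈ range n, c l * roundSeq a c m n s z n l := by
    refine sub_le_self _ (div_nonneg (sum_nonneg fun j _ => ?_) hD.le)
    exact rowPotential_nonneg (ha j) fun l => (roundSeq_mem hz n l).1
  have h3 : (∑ j ∈ range m, rowPotential (a j) n s z) / 16 ^ s ≤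
      (∑ l ∈ range n, c l * z l) / 2 := by
    have h4 : ∑ j ∈ range m, rowPotential (a j) n s z ≤ m * Real.exp s := by
      calc ∑ j ∈ range m, rowPotential (a j) n s z ≤ ∑ j ∈ range m, Real.exp s :=
            sum_le_sum fun j hj =>
              rowPotential_le (ha j) (fun l => (hz l).1) (haz j (mem_range.mp hj))
        _ = m * Real.exp s := by simp
    -- The base `16` only has to exceed `2 e`; the factor `2 ^ s` is then available to beat `2 m /
    -- v`.
    have h5 : Real.exp s * 2 ^ s ≤ 16 ^ s := by
      rw [← Real.exp_one_pow, ← mul_pow]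
      exact pow_le_pow_left₀ (by positivity) (by linarith [Real.exp_one_lt_d9]) s
    rw [div_le_iff₀ hD]
    -- The signs of the weights are not assumed here; nonnegativity of the value is read off from
    -- `hs`.
    have hv : 0 ≤ ∑ l ∈ range n, c l * z l := by
      by_contra hneg
      have h6 : (0 : ℝ) < 2 ^ s := by positivity
      nlinarith [(Nat.cast_nonneg m : (0 : ℝ) ≤ m)]
    nlinarith [mul_le_mul_of_nonneg_left h5 hv, Real.exp_pos (s : ℝ),
      mul_le_mul_of_nonneg_right hs (Real.exp_pos (s : ℝ)).le]
  rw [penalizedValue] at h1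
  linarith

/-- The number of the first `i` columns that are chosen and contained in the row `r`. -/
noncomputable def rowLoad (r y : ℕ → ℝ) (i : ℕ) : ℕ :=
  ((range i).filter fun l => r l = 1 ∧ y l = 1).card

theorem rowLoad_eq_sum {r y : ℕ → ℝ} {i : ℕ} (hr : ∀ l, r l = 0 ∨ r l = 1)
    (hy : ∀ l < i, y l = 0 ∨ y l = 1) : (rowLoad r y i : ℝ) = ∑ l ∈ range i, r l * y l := by
  rw [rowLoad, card_filter]
  push_cast
  refine sum_congr rfl fun l hl => ?_
  rcases hr l with h | h <;> rcases hy l (mem_range.mp hl) with h' | h' <;> simp [h, h']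

/-- The rows of the rounded point have small loads. -/
theorem rowLoad_roundSeq (ha : ∀ j l, a j l = 0 ∨ a j l = 1) (hz : ∀ l, 0 ≤ z l ∧ z l ≤ 1)
    (hc : ∀ l < n, c l ≤ 1) {j : ℕ} (hj : j < m) :
    rowLoad (a j) (roundSeq a c m n s z n) n = 0 ∨
      (s + 1) ^ (rowLoad (a j) (roundSeq a c m n s z n) n - 1) < 16 ^ s := by
  set y := roundSeq a c m n s z n with hy
  have ha0 : ∀ j l, 0 ≤ a j l := fun j l => by rcases ha j l with h | h <;> simp [h]
  suffices H : ∀ i ≤ n, rowLoad (a j) y i = 0 ∨ (s + 1) ^ (rowLoad (a j) y i - 1) < 16 ^ s from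
    H n le_rfl
  intro i
  induction i with
  | zero => exact fun _ => Or.inl (by simp [rowLoad])
  | succ i ih =>
    intro hi
    by_cases hi1 : a j i = 1 ∧ y i = 1
    · have hload : rowLoad (a j) y (i + 1) = rowLoad (a j) y i + 1 := by
        rw [rowLoad, range_add_one, filter_insert, if_pos hi1, card_insert_of_notMem (by simp)]
        rfl
      right
      rw [hload, Nat.add_sub_cancel]
      obtain ⟨haji, hyi⟩ := hi1
      set z' := Function.update (roundSeq a c m n s z i) i 0 with hz'
      have hz'0 : ∀ l, 0 ≤ z' l := by
        intro l
        rcases eq_or_ne l i with rfl | hl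
        · simp [hz']
        · rw [hz', Function.update_of_ne hl]
          exact (roundSeq_mem hz i l).1
      -- Column `i` was chosen, so its test at `z'` must have succeeded. The load there does not yet
      -- count `i`, whence the `- 1` in the exponent.
      have hcong : congestion a m n s z' i < c i * 16 ^ s := by
        rw [hy, roundSeq_of_lt (by omega), roundSeq, Function.update_self] at hyi
        by_contra hcon
        rw [if_neg hcon] at hyi
        exact zero_ne_one hyi
      have hfac : ∀ j l, 1 ≤ 1 + (s : ℝ) * (a j l * z' l) := by
        intro j l
        have : 0 ≤ (s : ℝ) * (a j l * z' l) :=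
          mul_nonneg (Nat.cast_nonneg s) (mul_nonneg (ha0 j l) (hz'0 l))
        linarith
      have hw : ((s : ℝ) + 1) ^ rowLoad (a j) y i ≤ rowWeight a n s z' j := by
        have hsub : ((range i).filter fun l => a j l = 1 ∧ y l = 1) ⊆ range n :=
          (filter_subset _ _).trans (range_subset_range.mpr (by omega))
        calc ((s : ℝ) + 1) ^ rowLoad (a j) y i
            = ∏ l ∈ (range i).filter fun l => a j l = 1 ∧ y l = 1,
                (1 + (s : ℝ) * (a j l * z' l)) := by
              rw [rowLoad, ← prod_const]
              refine prod_congr rfl fun l hl => ?_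
              simp only [mem_filter, mem_range] at hl
              -- Coordinates before `i` already have their final values in `z'`.
              have hzl : z' l = 1 := by
                rw [hz', Function.update_of_ne (by omega), roundSeq_of_lt hl.1, ← hl.2.2, hy,
                  roundSeq_of_lt (show l < n by omega)]
              rw [hl.2.1, hzl]
              ring
          _ ≤ rowWeight a n s z' j :=
              Finset.prod_le_prod_of_subset_of_one_le hsub
                (fun l _ => zero_le_one.trans (hfac j l)) fun l _ _ => hfac j l
      have hwc : rowWeight a n s z' j ≤ congestion a m n s z' i := by
        have := single_le_sum (f := fun j => a j i * rowWeight a n s z' j)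
          (fun j' _ => mul_nonneg (ha0 j' i)
            (prod_nonneg fun l _ => zero_le_one.trans (hfac j' l))) (mem_range.mpr hj)
        simpa [haji, congestion] using this
      have hci : c i * 16 ^ s ≤ 16 ^ s :=
        mul_le_of_le_one_left (by positivity) (hc i (by omega))
      have hfin : ((s : ℝ) + 1) ^ rowLoad (a j) y i < 16 ^ s :=
        (hw.trans hwc).trans_lt (hcong.trans_le hci)
      exact_mod_cast hfin
    · have hload : rowLoad (a j) y (i + 1) = rowLoad (a j) y i := by
        rw [rowLoad, range_add_one, filter_insert, if_neg hi1]
        rfl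
      rw [hload]
      exact ih (by omega)

end Rounding

/-! ### Comparison with the error bound -/

/-- This transfers `s ≤ 6 u` to `s / log (s + 1) = O(u / log u)`. If `s + 1 ≥ √u`, then `log u ≤ 2
log (s + 1)`; otherwise `s ≤ √u`, and `log √u ≤ √u` already gives `s log u ≤ 2 u`. -/
theorem mul_log_le_of_le {s : ℕ} {u : ℝ} (hs : 1 ≤ s) (hu : 1 ≤ u) (hsu : (s : ℝ) ≤ 6 * u) :
    s * Real.log u ≤ 12 * u * Real.log (s + 1) := by
  have hs' : (1 : ℝ) ≤ s := by exact_mod_cast hs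
  have hlog2 : (0.69 : ℝ) ≤ Real.log (s + 1) :=
    (by linarith [Real.log_two_gt_d9] : (0.69 : ℝ) ≤ Real.log 2).trans
      (Real.log_le_log (by norm_num) (by linarith))
  have hu0 : 0 ≤ Real.log u := Real.log_nonneg hu
  have hsqrt : Real.log u = 2 * Real.log (√u) := by
    rw [Real.log_sqrt (by linarith)]
    ring
  have hpos : 0 < √u := Real.sqrt_pos.mpr (by linarith)
  have hsq : √u * √u = u := Real.mul_self_sqrt (by linarith)
  rcases le_or_gt (√u) (s + 1) with h | h
  · have h1 : Real.log (√u) ≤ Real.log (s + 1) := Real.log_le_log hpos h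
    rw [hsqrt] at hu0 ⊢
    nlinarith
  · have h1 : Real.log (√u) ≤ √u := (Real.log_le_sub_one_of_pos hpos).trans (by linarith)
    have h2 : (s : ℝ) * Real.log (√u) ≤ √u * √u :=
      mul_le_mul (by linarith) h1 (by linarith) hpos.le
    rw [hsqrt]
    nlinarith

/-- It is used with `Y = m k p / n` and `L = log m`. The sum is at most `e ^ 2` times the product `V
= Y L ^ 2`, and `V` stays away from `1`, so the additive constant `2` is absorbed: `14 log V ≥ 2`.
-/
theorem log_add_le_log_mul {Y L : ℝ} (hY : 1 / 4 < Y) (hL : 0.69 ≤ L)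
    (he : Real.exp 1 < Y * L + L) : Real.log (Y * L + L) ≤ 15 * Real.log (Y * L * L) := by
  have he' : 2.718 < Y * L + L := by linarith [Real.exp_one_gt_d9]
  obtain ⟨Z, hZ⟩ : ∃ Z, Z = Y * L + L := ⟨_, rfl⟩
  obtain ⟨V, hV⟩ : ∃ V, V = Y * L * L := ⟨_, rfl⟩
  rw [← hZ] at he he' ⊢
  rw [← hV]
  have hZV : Z ^ 2 ≤ 53 * V ^ 2 := by
    have h1 : (1 + Y) ^ 2 ≤ 25 * Y ^ 2 := by nlinarith
    have h2 : 1 ≤ 2.12 * L ^ 2 := by nlinarith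
    have h3 : Z ^ 2 = (1 + Y) ^ 2 * L ^ 2 := by rw [hZ]; ring
    have h4 : V ^ 2 = Y ^ 2 * L ^ 2 * L ^ 2 := by rw [hV]; ring
    rw [h3, h4]
    have h5 : (1 + Y) ^ 2 * L ^ 2 ≤ 25 * Y ^ 2 * L ^ 2 :=
      mul_le_mul_of_nonneg_right h1 (sq_nonneg L)
    have h6 : 0 ≤ Y ^ 2 * L ^ 2 := by positivity
    nlinarith
  -- For `Y ≤ 3` this comes from `V (1 + Y) ^ 2 = Y Z ^ 2` and `Z > 2.718`; for larger `Y` the lower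
  -- bound on `L` suffices.
  have hVlow : 1.17 ≤ V := by
    rcases le_or_gt Y 3 with hY3 | hY3
    · have h1 : 2.718 ^ 2 ≤ Z ^ 2 := pow_le_pow_left₀ (by norm_num) he'.le 2
      have h2 : V * (1 + Y) ^ 2 = Y * Z ^ 2 := by rw [hV, hZ]; ring
      have h3 : 1.17 * (1 + Y) ^ 2 ≤ Y * 2.718 ^ 2 := by nlinarith
      have h4 : 1.17 * (1 + Y) ^ 2 ≤ V * (1 + Y) ^ 2 := by
        rw [h2]
        exact h3.trans (mul_le_mul_of_nonneg_left h1 (by linarith))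
      exact le_of_mul_le_mul_right h4 (by positivity)
    · have h1 : 0.69 * 0.69 ≤ L * L := mul_le_mul hL hL (by norm_num) (by linarith)
      rw [hV, mul_assoc]
      nlinarith
  have h1 : 53 * V ^ 2 ≤ (Real.exp 2 * V) ^ 2 := by
    have h54 : (53 : ℝ) ≤ Real.exp 2 ^ 2 := by
      rw [← Real.exp_nat_mul, show ((2 : ℕ) : ℝ) * 2 = (4 : ℕ) by norm_num, ← Real.exp_one_pow]
      refine le_trans ?_ (pow_le_pow_left₀ (by norm_num : (0 : ℝ) ≤ 2.718)
        (by linarith [Real.exp_one_gt_d9]) 4)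
      norm_num
    rw [mul_pow]
    exact mul_le_mul_of_nonneg_right h54 (sq_nonneg V)
  have h2 : Z ≤ Real.exp 2 * V :=
    (pow_le_pow_iff_left₀ (by linarith) (by positivity) two_ne_zero).mp (hZV.trans h1)
  have h3 : Real.log Z ≤ 2 + Real.log V := by
    refine (Real.log_le_log (by linarith) h2).trans ?_
    rw [Real.log_mul (Real.exp_pos _).ne' (by linarith), Real.log_exp]
  have h4 : 0.145 ≤ Real.log V := by
    have h5 := Real.one_sub_inv_le_log_of_pos (show 0 < V by linarith)
    have h6 : V⁻¹ ≤ 0.855 := by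
      rw [inv_le_comm₀ (by linarith) (by norm_num)]
      refine le_trans ?_ hVlow
      norm_num
    linarith
  linarith

/-- With `Z = Y L + L`, the bound `8 Y ≤ e ^ (5 / 2) Z` gives `0.69 s ≤ 5 / 2 + log Z`, and `log Z >
1` absorbs the constant. -/
theorem natCast_le_six_mul_log {Y L : ℝ} {s : ℕ} (hY : 1 / 4 < Y) (hL : 0.69 ≤ L)
    (he : Real.exp 1 < Y * L + L) (hs : (2 : ℝ) ^ s < 8 * Y) :
    (s : ℝ) ≤ 6 * Real.log (Y * L + L) := by
  have hY' : Y ≤ (Y * L + L) / 0.69 := by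
    rw [le_div_iff₀ (by norm_num)]
    nlinarith
  obtain ⟨Z, hZ⟩ : ∃ Z, Z = Y * L + L := ⟨_, rfl⟩
  rw [← hZ] at he hY' ⊢
  have hZ0 : 0 < Z := (Real.exp_pos 1).trans he
  have hu : 1 < Real.log Z := (Real.lt_log_iff_exp_lt hZ0).mpr he
  have h11 : (11.6 : ℝ) ≤ Real.exp (5 / 2) := by
    refine (pow_le_pow_iff_left₀ (by norm_num) (Real.exp_pos _).le two_ne_zero).mp ?_
    rw [← Real.exp_nat_mul, show ((2 : ℕ) : ℝ) * (5 / 2) = (5 : ℕ) by norm_num,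
      ← Real.exp_one_pow]
    refine le_trans ?_ (pow_le_pow_left₀ (by norm_num : (0 : ℝ) ≤ 2.718)
      (by linarith [Real.exp_one_gt_d9]) 5)
    norm_num
  have h1 : (2 : ℝ) ^ s ≤ Real.exp (5 / 2) * Z := by
    have h2 : 8 * (Z / 0.69) ≤ 11.6 * Z := by
      rw [← mul_div_assoc, div_le_iff₀ (by norm_num)]
      nlinarith
    have h3 := mul_le_mul_of_nonneg_right h11 hZ0.le
    linarith
  have h2 : (s : ℝ) * Real.log 2 ≤ 5 / 2 + Real.log Z := by
    rw [← Real.log_pow, ← Real.log_exp (5 / 2), ← Real.log_mul (Real.exp_pos _).ne' hZ0.ne']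
    exact Real.log_le_log (by positivity) h1
  have h3 : (s : ℝ) * 0.69 ≤ s * Real.log 2 :=
    mul_le_mul_of_nonneg_left (by linarith [Real.log_two_gt_d9]) (Nat.cast_nonneg s)
  linarith

theorem natCast_le_div_log {s N : ℕ} {u : ℝ} (hspos : 1 ≤ s) (hu1 : 1 < u)
    (hsu : (s : ℝ) ≤ 6 * u) (hNpos : 1 ≤ N) (hN : (s + 1) ^ (N - 1) < 16 ^ s) :
    (N : ℝ) ≤ 35 * (u / Real.log u) := by
  have hlogu : 0 < Real.log u := Real.log_pos hu1
  have hkey := mul_log_le_of_le hspos hu1.le hsu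
  have hlogs : 0 < Real.log ((s : ℝ) + 1) := Real.log_pos (by
    have : (1 : ℝ) ≤ s := by exact_mod_cast hspos
    linarith)
  have hNlog : ((N : ℝ) - 1) * Real.log (s + 1) ≤ s * Real.log 16 := by
    have h1 : ((s : ℝ) + 1) ^ (N - 1) ≤ 16 ^ s := by exact_mod_cast hN.le
    have h2 := Real.log_le_log (by positivity) h1
    rw [Real.log_pow, Real.log_pow, Nat.cast_sub hNpos] at h2
    simpa using h2
  have hlog16 : Real.log 16 ≤ 2.8 := by
    rw [show (16 : ℝ) = 2 ^ 4 by norm_num, Real.log_pow]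
    have := Real.log_two_lt_d9
    norm_num
    linarith
  have hN1 : ((N : ℝ) - 1) * Real.log u ≤ 34 * u := by
    have h1 : ((N : ℝ) - 1) * Real.log u * Real.log (s + 1) ≤ 34 * u * Real.log (s + 1) := by
      have h2 := mul_le_mul_of_nonneg_right hNlog hlogu.le
      have h3 := mul_le_mul_of_nonneg_left hlog16 (mul_nonneg (Nat.cast_nonneg s) hlogu.le)
      have h4 : 0 ≤ u * Real.log (s + 1) := by positivity
      linarith
    exact le_of_mul_le_mul_right h1 hlogs
  -- The missing unit in `N - 1` costs `log u ≤ u`, which raises `34` to `35`.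
  have hlogu' : Real.log u ≤ u - 1 := Real.log_le_sub_one_of_pos (by linarith)
  rw [← mul_div_assoc, le_div_iff₀ hlogu]
  linarith

theorem load_le_errorBound {m n k : ℕ} {p : ℝ}
    (h : Real.exp 1 < load m n k p + Real.log m) {s N : ℕ}
    (hs : 1 ≤ s → (2 : ℝ) ^ s < 8 * ((m : ℝ) * k * p / n))
    (hN : N = 0 ∨ (s + 1) ^ (N - 1) < 16 ^ s) :
    (N : ℝ) ≤ 600 * errorBound m n k p := by
  have ht : 0 ≤ errorBound m n k p := le_max_left _ _
  rcases Nat.eq_zero_or_pos N with rfl | hNpos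
  · simpa using ht
  have hN' : (s + 1) ^ (N - 1) < 16 ^ s := hN.resolve_left (by omega)
  -- For `s = 0` the strict inequality reads `1 < 1`, so all loads vanish in that case.
  rcases Nat.eq_zero_or_pos s with rfl | hspos
  · simp at hN'
  have hload : load m n k p = (m : ℝ) * k * p / n * Real.log m := by
    rw [load]
    ring
  have h2s := hs hspos
  rw [hload] at h
  have hY : 1 / 4 < (m : ℝ) * k * p / n := by
    have : (2 : ℝ) ≤ 2 ^ s := by
      simpa using pow_le_pow_right₀ (a := (2 : ℝ)) (by norm_num) hspos
    linarith
  have hL : 0.69 ≤ Real.log m := by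
    have hm : 2 ≤ m := by
      by_contra hm
      have hL0 : Real.log m = 0 := by interval_cases m <;> simp
      rw [hL0] at h
      have := Real.exp_pos 1
      linarith
    refine (by linarith [Real.log_two_gt_d9] : (0.69 : ℝ) ≤ Real.log 2).trans ?_
    exact Real.log_le_log (by norm_num) (by exact_mod_cast hm)
  have hu : 1 < Real.log ((m : ℝ) * k * p / n * Real.log m + Real.log m) :=
    (Real.lt_log_iff_exp_lt ((Real.exp_pos 1).trans h)).mpr h
  have hlogu := Real.log_pos hu
  have h1 := natCast_le_div_log hspos hu (natCast_le_six_mul_log hY hL h h2s) hNpos hN'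
  have h2 := log_add_le_log_mul hY hL h
  have h3 : Real.log ((m : ℝ) * k * p / n * Real.log m + Real.log m) /
      Real.log (Real.log ((m : ℝ) * k * p / n * Real.log m + Real.log m)) ≤
        15 * errorBound m n k p := by
    rw [errorBound, hload, ← Real.log_mul (by positivity) (by positivity)]
    refine le_trans ?_ (mul_le_mul_of_nonneg_left (le_max_right _ _) (by norm_num))
    rw [← mul_div_assoc]
    exact div_le_div_of_nonneg_right h2 hlogu.le
  linarith

/-! ### The program

Array `4` holds the current point and array `5` the scalar variables: the number `k` of ones in a
row, the objective value `v`, the quotient `q`, the exponent `s`, the factor `D = 16 ^ s`, the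
column `i`, the congestion `S`, the row `j`, the row weight `w` and the column `l`. -/

namespace RoundingProgram

open Finset

/-- The scalar variable `r`. -/
def var (r : ℕ) : Expr := .get 5 (.const r)

/-- Assignment to the scalar variable `r`. -/
def setVar (r : ℕ) (e : Expr) : Prog := .assign 5 (.const r) e

/-- Run `P` with the scalar variable `r` ranging from `0` to `b - 1`. -/
def forLoop (r : ℕ) (b : Expr) (P : Prog) : Prog :=
  .seq (setVar r (.const 0))
    (.while (.lt (var r) b) (.seq P (setVar r (.add (var r) (.const 1)))))

/-- The number of rows. -/
def rowsExpr : Expr := .get 0 (.const 0)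

/-- The number of columns. -/
def colsExpr : Expr := .get 0 (.const 1)

/-- The matrix entry whose indices are held by the scalar variables `j` and `l`. -/
def entryExpr (j l : ℕ) : Expr := .get 1 (.add (.mul (var j) colsExpr) (var l))

/-- Compute `k`. -/
def countProg : Prog :=
  .seq (setVar 0 (.const 0)) (forLoop 5 colsExpr (setVar 0 (.add (var 0) (.get 1 (var 5)))))

/-- Compute the initial point and its objective value `v`. -/
def initProg : Prog :=
  .seq (setVar 1 (.const 0)) (forLoop 5 colsExpr
    (.seq (.assign 4 (var 5) (.add (.div (.get 3 (var 5)) (.const 2))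
        (.div (.const 1) (.mul (.const 2) (var 0)))))
      (setVar 1 (.add (var 1) (.mul (.get 2 (var 5)) (.get 4 (var 5)))))))

/-- Compute `s` and `D`. -/
def scaleProg : Prog :=
  .seq (setVar 2 (.div (.mul (.const 2) rowsExpr) (var 1)))
    (.seq (setVar 3 (.const 0)) (.seq (setVar 4 (.const 1))
      (.while (.lt (.const 1) (var 2))
        (.seq (setVar 2 (.div (var 2) (.const 2)))
          (.seq (setVar 3 (.add (var 3) (.const 1))) (setVar 4 (.mul (var 4) (.const 16))))))))

/-- Compute the weight `w` of row `j`. -/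
def rowWeightProg : Prog :=
  .seq (setVar 8 (.const 1)) (forLoop 9 colsExpr (setVar 8 (.mul (var 8)
    (.add (.const 1) (.mul (var 3) (.mul (entryExpr 7 9) (.get 4 (var 9))))))))

/-- Compute the congestion `S` of column `i`. -/
def congestionProg : Prog :=
  .seq (setVar 6 (.const 0)) (forLoop 7 rowsExpr
    (.seq rowWeightProg (setVar 6 (.add (var 6) (.mul (entryExpr 7 5) (var 8))))))

/-- Round the coordinates one after the other. -/
def roundProg : Prog :=
  forLoop 5 colsExpr (.seq (.assign 4 (var 5) (.const 0)) (.seq congestionProg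
    (.assign 4 (var 5) (.lt (var 6) (.mul (.get 2 (var 5)) (var 4))))))

/-- The whole algorithm. -/
def program : Prog := .seq countProg (.seq initProg (.seq scaleProg roundProg))

/-- `M` still holds the input `I` and the point `z`, and its contents have height at most `h`. -/
structure Holds (h : ℕ) (I : Memory) (z : ℕ → ℚ) (M : Memory) : Prop where
  input : ∀ a < 4, M a = I a
  point : M 4 = z
  htLe : ∀ a l, HtLe (M a l) h

/-! ### Correctness of the subprograms -/

variable {h R : ℕ} {I M : Memory} {z : ℕ → ℚ} {post : Memory → Prop}

theorem write_self (M : Memory) (a l : ℕ) (q : ℚ) : M.write a l q a l = q := by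
  simp [Memory.write]

theorem write_of_ne (M : Memory) {a l l' : ℕ} (q : ℚ) (hl : l' ≠ l) :
    M.write a l q a l' = M a l' := by
  simp [Memory.write, hl]

theorem Holds.one_le (hM : Holds h I z M) : 1 ≤ h := (hM.htLe 0 0).one_le

theorem Holds.write_scalar (hM : Holds h I z M) {q : ℚ} (hq : HtLe q h) (r : ℕ) :
    Holds h I z (M.write 5 r q) where
  input a ha := by
    rw [← hM.input a ha]
    funext l
    simp [Memory.write, show a ≠ 5 by omega]
  point := by
    rw [← hM.point]
    funext l
    simp [Memory.write]
  htLe a l := by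
    unfold Memory.write
    split_ifs
    exacts [hq, hM.htLe a l]

theorem Holds.write_point (hM : Holds h I z M) {q : ℚ} (hq : HtLe q h) (l : ℕ) :
    Holds h I (Function.update z l q) (M.write 4 l q) where
  input a ha := by
    rw [← hM.input a ha]
    funext l
    simp [Memory.write, show a ≠ 4 by omega]
  point := by
    rw [← hM.point]
    funext l'
    simp [Memory.write, Function.update_apply]
  htLe a l := by
    unfold Memory.write
    split_ifs
    exacts [hq, hM.htLe a l]

theorem write_point_scalar (M : Memory) (l r : ℕ) (q : ℚ) : M.write 4 l q 5 r = M 5 r := by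
  simp [Memory.write]

theorem eval_var (r : ℕ) (M : Memory) : (var r).eval M = M 5 r := by
  simp [var, Expr.eval]

theorem eval_get_var {r i : ℕ} (a : ℕ) (hr : M 5 r = i) :
    (Expr.get a (var r)).eval M = M a i := by
  rw [Expr.eval, eval_var, hr, Nat.floor_natCast]

theorem Holds.eval_colsExpr (hM : Holds h I z M) : colsExpr.eval M = I 0 1 := by
  simp [colsExpr, Expr.eval, hM.input]

theorem Holds.eval_rowsExpr (hM : Holds h I z M) : rowsExpr.eval M = I 0 0 := by
  simp [rowsExpr, Expr.eval, hM.input]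

theorem Holds.eval_entryExpr (hM : Holds h I z M) {n r r' j l : ℕ} (hn : I 0 1 = n)
    (hj : M 5 r = j) (hl : M 5 r' = l) : (entryExpr r r').eval M = I 1 (j * n + l) := by
  rw [entryExpr, Expr.eval, Expr.eval, Expr.eval, eval_var, eval_var, hM.eval_colsExpr, hn, hj, hl,
    ← Nat.cast_mul, ← Nat.cast_add, Nat.floor_natCast, hM.input 1 (by norm_num)]

theorem haltsWith_setVar {r : ℕ} {e : Expr} (hM : Holds h I z M)
    (hpost : post (M.write 5 r (e.eval M))) : HaltsWith h R (setVar r e) M post := by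
  refine HaltsWith.assign hM.one_le hM.htLe ?_
  simpa [Expr.eval] using hpost

theorem haltsWith_assign_var {a r i : ℕ} {e : Expr} (hM : Holds h I z M) (hr : M 5 r = i)
    (hpost : post (M.write a i (e.eval M))) : HaltsWith h R (.assign a (var r) e) M post := by
  refine HaltsWith.assign hM.one_le hM.htLe ?_
  rwa [eval_var, hr, Nat.floor_natCast]

/-- The family `Z` lets the stored point change from pass to pass. By `hframe` the invariant
survives overwriting the counter, and the body has to leave the counter unchanged. -/
theorem haltsWith_forLoop {r N : ℕ} {b : Expr} {P : Prog} (Z : ℕ → ℕ → ℚ) (inv : ℕ → Memory → Prop)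
    (hN : N ≤ 2 ^ h) (hNR : N + 1 ≤ R) (hinv : ∀ i M, inv i M → Holds h I (Z i) M)
    (hframe : ∀ i M q, HtLe q h → inv i M → inv i (M.write 5 r q))
    (hb : ∀ i M, inv i M → b.eval M = N)
    (hstep : ∀ i < N, ∀ M, inv i M → M 5 r = i →
      HaltsWith h R P M fun M' => inv (i + 1) M' ∧ M' 5 r = i)
    (h0 : inv 0 M) : HaltsWith h R (forLoop r b P) M (inv N) := by
  have hh : 1 ≤ h := (hinv 0 M h0).one_le
  have hht : ∀ i ≤ N, HtLe (i : ℚ) h := fun i hi => HtLe.natCast hh (hi.trans hN)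
  refine HaltsWith.seq (mid := fun M' => inv 0 M' ∧ M' 5 r = (0 : ℕ)) (by omega) hh ?_ ?_
  · refine haltsWith_setVar (hinv 0 M h0) ⟨hframe 0 M _ ?_ h0, by simp [write_self, Expr.eval]⟩
    simpa [Expr.eval] using HtLe.zero hh
  · intro M₁ hM₁
    refine (HaltsWith.loop (fun i M => inv i M ∧ M 5 r = i) hNR hh
      (fun i M hM => (hinv i M hM.1).htLe) ?_ ?_ hM₁).mono fun M' hM' => hM'.1
    · intro i hi M hM
      constructor
      · rw [Expr.eval, eval_var, hb i M hM.1, hM.2, if_pos (by exact_mod_cast hi)]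
        exact one_ne_zero
      · refine HaltsWith.seq (by omega) hh (hstep i hi M hM.1 hM.2) fun M' hM' => ?_
        have hval : (Expr.add (var r) (.const 1)).eval M' = ((i + 1 : ℕ) : ℚ) := by
          rw [Expr.eval, eval_var, hM'.2, Expr.eval]
          push_cast
          rfl
        refine haltsWith_setVar (hinv _ _ hM'.1) ?_
        rw [hval]
        exact ⟨hframe _ _ _ (hht _ hi) hM'.1, write_self _ _ _ _⟩
    · intro M hM
      rw [Expr.eval, eval_var, hb N M hM.1, hM.2, if_neg (lt_irrefl _)]

section Specification

variable {m n s i j : ℕ}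

theorem haltsWith_rowWeightProg (hn : I 0 1 = n) (hnh : n ≤ 2 ^ h) (hnR : n + 1 ≤ R)
    (hM : Holds h I z M) (hs : M 5 3 = s) (hj : M 5 7 = j)
    (hw : ∀ l ≤ n, HtLe (rowWeight (fun j l => I 1 (j * n + l)) l s z j) h) :
    HaltsWith h R rowWeightProg M fun M' => Holds h I z M' ∧ (∀ r < 8, M' 5 r = M 5 r) ∧
      M' 5 8 = rowWeight (fun j l => I 1 (j * n + l)) n s z j := by
  set inv : ℕ → Memory → Prop := fun l M' => Holds h I z M' ∧ (∀ r < 8, M' 5 r = M 5 r) ∧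
      M' 5 8 = rowWeight (fun j l => I 1 (j * n + l)) l s z j
  have hh := hM.one_le
  refine HaltsWith.seq (mid := inv 0) (by omega) hh ?_ fun M₁ hM₁ => ?_
  · refine haltsWith_setVar hM ⟨hM.write_scalar ?_ 8, fun r hr => ?_, ?_⟩
    · simpa [Expr.eval] using HtLe.one hh
    · rw [write_of_ne _ _ (by omega)]
    · rw [write_self]
      simp [Expr.eval, rowWeight]
  · refine haltsWith_forLoop (fun _ => z) inv hnh hnR (fun _ _ hM => hM.1) ?_ ?_ ?_ hM₁
    · rintro l M' q hq ⟨h1, h2, h3⟩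
      refine ⟨h1.write_scalar hq 9, fun r hr => ?_, ?_⟩
      · rw [write_of_ne _ _ (by omega), h2 r hr]
      · rw [write_of_ne _ _ (by omega), h3]
    · intro l M' hM'
      rw [hM'.1.eval_colsExpr, hn]
    · rintro l hl M' ⟨h1, h2, h3⟩ hl'
      have hval : (Expr.mul (var 8) (.add (.const 1) (.mul (var 3) (.mul (entryExpr 7 9)
          (.get 4 (var 9)))))).eval M' =
            rowWeight (fun j l => I 1 (j * n + l)) (l + 1) s z j := by
        rw [Expr.eval, eval_var, h3, Expr.eval, Expr.eval, Expr.eval, eval_var, h2 3 (by omega), hs,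
          Expr.eval, h1.eval_entryExpr hn ((h2 7 (by omega)).trans hj) hl', eval_get_var 4 hl',
          h1.point, rowWeight, rowWeight, prod_range_succ]
      refine haltsWith_setVar h1 ?_
      rw [hval]
      refine ⟨⟨h1.write_scalar (hw _ hl) 8, fun r hr => ?_, write_self _ _ _ _⟩, ?_⟩
      · rw [write_of_ne _ _ (by omega), h2 r hr]
      · rw [write_of_ne _ _ (by omega), hl']

theorem haltsWith_congestionProg (hm : I 0 0 = m) (hn : I 0 1 = n) (hmh : m ≤ 2 ^ h)
    (hnh : n ≤ 2 ^ h) (hmR : m + 1 ≤ R) (hnR : n + 1 ≤ R)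
    (hM : Holds h I z M) (hs : M 5 3 = s) (hi : M 5 5 = i)
    (hw : ∀ j < m, ∀ l ≤ n, HtLe (rowWeight (fun j l => I 1 (j * n + l)) l s z j) h)
    (hS : ∀ j ≤ m, HtLe (congestion (fun j l => I 1 (j * n + l)) j n s z i) h) :
    HaltsWith h R congestionProg M fun M' => Holds h I z M' ∧ (∀ r < 6, M' 5 r = M 5 r) ∧
      M' 5 6 = congestion (fun j l => I 1 (j * n + l)) m n s z i := by
  set inv : ℕ → Memory → Prop := fun j M' => Holds h I z M' ∧ (∀ r < 6, M' 5 r = M 5 r) ∧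
      M' 5 6 = congestion (fun j l => I 1 (j * n + l)) j n s z i
  have hh := hM.one_le
  refine HaltsWith.seq (mid := inv 0) (by omega) hh ?_ fun M₁ hM₁ => ?_
  · refine haltsWith_setVar hM ⟨hM.write_scalar ?_ 6, fun r hr => ?_, ?_⟩
    · simpa [Expr.eval] using HtLe.zero hh
    · rw [write_of_ne _ _ (by omega)]
    · rw [write_self]
      simp [Expr.eval, congestion]
  · refine haltsWith_forLoop (fun _ => z) inv hmh hmR (fun _ _ hM => hM.1) ?_ ?_ ?_ hM₁
    · rintro j M' q hq ⟨h1, h2, h3⟩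
      refine ⟨h1.write_scalar hq 7, fun r hr => ?_, ?_⟩
      · rw [write_of_ne _ _ (by omega), h2 r hr]
      · rw [write_of_ne _ _ (by omega), h3]
    · intro l M' hM'
      rw [hM'.1.eval_rowsExpr, hm]
    · rintro j hj M' ⟨h1, h2, h3⟩ hj'
      refine HaltsWith.seq (by omega) hh (haltsWith_rowWeightProg hn hnh hnR h1
        ((h2 3 (by omega)).trans hs) hj' (hw j hj)) ?_
      rintro M₂ ⟨h4, h5, h6⟩
      have hval : (Expr.add (var 6) (.mul (entryExpr 7 5) (var 8))).eval M₂ =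
          congestion (fun j l => I 1 (j * n + l)) (j + 1) n s z i := by
        rw [Expr.eval, Expr.eval, eval_var, eval_var, h5 6 (by omega), h3, h6,
          h4.eval_entryExpr hn ((h5 7 (by omega)).trans hj')
            ((h5 5 (by omega)).trans ((h2 5 (by omega)).trans hi)),
          congestion, congestion, sum_range_succ]
      refine haltsWith_setVar h4 ?_
      rw [hval]
      refine ⟨⟨h4.write_scalar (hS _ hj) 6, fun r hr => ?_, write_self _ _ _ _⟩, ?_⟩
      · rw [write_of_ne _ _ (by omega), h5 r (by omega), h2 r hr]
      · rw [write_of_ne _ _ (by omega), h5 7 (by omega), hj']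

theorem haltsWith_roundProg (hm : I 0 0 = m) (hn : I 0 1 = n) (hmh : m ≤ 2 ^ h)
    (hnh : n ≤ 2 ^ h) (hmR : m + 1 ≤ R) (hnR : n + 1 ≤ R)
    (hM : Holds h I z M) (hs : M 5 3 = s) (hD : M 5 4 = 16 ^ s)
    (hw : ∀ i < n, ∀ j < m, ∀ l ≤ n, HtLe (rowWeight (fun j l => I 1 (j * n + l)) l s
      (Function.update (roundSeq (fun j l => I 1 (j * n + l)) (I 2) m n s z i) i 0) j) h)
    (hS : ∀ i < n, ∀ j ≤ m, HtLe (congestion (fun j l => I 1 (j * n + l)) j n s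
      (Function.update (roundSeq (fun j l => I 1 (j * n + l)) (I 2) m n s z i) i 0) i) h) :
    HaltsWith h R roundProg M fun M' =>
      M' 4 = roundSeq (fun j l => I 1 (j * n + l)) (I 2) m n s z n := by
  have hh := hM.one_le
  set Z := roundSeq (fun j l => I 1 (j * n + l)) (I 2) m n s z with hZ
  refine (haltsWith_forLoop Z (fun i M' => Holds h I (Z i) M' ∧ M' 5 3 = s ∧ M' 5 4 = 16 ^ s)
    hnh hnR (fun _ _ hM => hM.1) ?_ ?_ ?_ ⟨hM, hs, hD⟩).mono fun M' hM' => hM'.1.point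
  · rintro i M' q hq ⟨h1, h2, h3⟩
    refine ⟨h1.write_scalar hq 5, ?_, ?_⟩
    · rw [write_of_ne _ _ (by omega), h2]
    · rw [write_of_ne _ _ (by omega), h3]
  · intro l M' hM'
    rw [hM'.1.eval_colsExpr, hn]
  · rintro i hi M₁ ⟨h1, h2, h3⟩ hi'
    refine HaltsWith.seq (mid := fun M' => Holds h I (Function.update (Z i) i 0) M' ∧
      ∀ r, M' 5 r = M₁ 5 r) (by omega) hh ?_ ?_
    · refine haltsWith_assign_var h1 hi' ⟨?_, fun r => write_point_scalar _ _ _ _⟩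
      rw [Expr.eval]
      exact h1.write_point (HtLe.zero hh) i
    · rintro M₂ ⟨h4, h5⟩
      refine HaltsWith.seq (by omega) hh (haltsWith_congestionProg hm hn hmh hnh hmR hnR h4
        ((h5 3).trans h2) ((h5 5).trans hi') (hw i hi) (hS i hi)) ?_
      rintro M₃ ⟨h6, h7, h8⟩
      have hi₃ : M₃ 5 5 = i := (h7 5 (by omega)).trans ((h5 5).trans hi')
      refine haltsWith_assign_var h6 hi₃ ?_
      rw [Expr.eval, eval_var, h8, Expr.eval, eval_var, eval_get_var 2 hi₃, h7 4 (by omega), h5, h3,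
        h6.input 2 (by omega)]
      refine ⟨⟨?_, ?_, ?_⟩, ?_⟩
      · have := h6.write_point (HtLe.ite_one_zero (p := congestion (fun j l => I 1 (j * n + l)) m n
          s (Function.update (Z i) i 0) i < I 2 i * 16 ^ s) hh) i
        rwa [Function.update_idem] at this
      · rw [write_point_scalar, h7 3 (by omega), h5, h2]
      · rw [write_point_scalar, h7 4 (by omega), h5, h3]
      · rw [write_point_scalar, hi₃]

end Specification

end RoundingProgram

namespace RoundingProgram

open Finset

/-- The mean of `x` and of the constant vector `1 / k` on the first `n` coordinates. -/
def startPoint {K : Type*} [Field K] (x : ℕ → K) (k : K) (n : ℕ) : ℕ → K :=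
  fun l => if l < n then x l / 2 + 1 / (2 * k) else 0

/-- The least `s` with `q ≤ 2 ^ s`. -/
def halvings {K : Type*} [Field K] [LinearOrder K] [FloorSemiring K] (q : K) : ℕ :=
  Nat.clog 2 ⌈q⌉₊

/-- The analysis uses `s` only through this equivalence, which passes from `ℚ` to `ℝ` and also
covers negative `q`. -/
theorem halvings_le_iff {K : Type*} [Field K] [LinearOrder K] [FloorSemiring K]
    {q : K} {s : ℕ} : halvings q ≤ s ↔ q ≤ 2 ^ s := by
  rw [halvings, Nat.clog_le_iff_le_pow (by norm_num), Nat.ceil_le]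
  push_cast
  rfl

variable {h R : ℕ} {I M : Memory} {z : ℕ → ℚ} {m n : ℕ}

theorem haltsWith_countProg (hn : I 0 1 = n) (hnh : n ≤ 2 ^ h) (hnR : n + 1 ≤ R)
    (hM : Holds h I z M) (hk : ∀ i ≤ n, HtLe (∑ l ∈ range i, I 1 l) h) :
    HaltsWith h R countProg M fun M' => Holds h I z M' ∧ M' 5 0 = ∑ l ∈ range n, I 1 l := by
  set inv : ℕ → Memory → Prop := fun i M' => Holds h I z M' ∧ M' 5 0 = ∑ l ∈ range i, I 1 l
  have hh := hM.one_le
  refine HaltsWith.seq (mid := inv 0) (by omega) hh ?_ fun M₁ hM₁ => ?_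
  · refine haltsWith_setVar hM ⟨hM.write_scalar ?_ 0, ?_⟩
    · simpa [Expr.eval] using HtLe.zero hh
    · rw [write_self]
      simp [Expr.eval]
  · refine haltsWith_forLoop (fun _ => z) inv hnh hnR (fun _ _ hM => hM.1) ?_ ?_ ?_ hM₁
    · rintro i M' q hq ⟨h1, h2⟩
      exact ⟨h1.write_scalar hq 5, by rw [write_of_ne _ _ (by omega), h2]⟩
    · intro i M' hM'
      rw [hM'.1.eval_colsExpr, hn]
    · rintro i hi M' ⟨h1, h2⟩ hi'
      have hval : (Expr.add (var 0) (.get 1 (var 5))).eval M' = ∑ l ∈ range (i + 1), I 1 l := by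
        rw [Expr.eval, eval_var, h2, eval_get_var 1 hi', h1.input 1 (by omega), sum_range_succ]
      refine haltsWith_setVar h1 ?_
      rw [hval]
      exact ⟨⟨h1.write_scalar (hk _ hi) 0, write_self _ _ _ _⟩,
        by rw [write_of_ne _ _ (by omega), hi']⟩

theorem haltsWith_initProg {k : ℚ} (hn : I 0 1 = n) (hnh : n ≤ 2 ^ h) (hnR : n + 1 ≤ R)
    (hM : Holds h I (fun _ => 0) M) (hk : M 5 0 = k)
    (hz : ∀ l < n, HtLe (I 3 l / 2 + 1 / (2 * k)) h)
    (hv : ∀ i ≤ n, HtLe (∑ l ∈ range i, I 2 l * startPoint (I 3) k n l) h) :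
    HaltsWith h R initProg M fun M' => Holds h I (startPoint (I 3) k n) M' ∧
      M' 5 1 = ∑ l ∈ range n, I 2 l * startPoint (I 3) k n l := by
  set Z : ℕ → ℕ → ℚ := fun i => startPoint (I 3) k i with hZ
  set inv : ℕ → Memory → Prop := fun i M' => Holds h I (Z i) M' ∧ M' 5 0 = k ∧
    M' 5 1 = ∑ l ∈ range i, I 2 l * startPoint (I 3) k n l
  have hh := hM.one_le
  refine HaltsWith.seq (mid := inv 0) (by omega) hh ?_ fun M₁ hM₁ => ?_
  · have hZ0 : Z 0 = fun _ => 0 := by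
      funext l
      simp [hZ, startPoint]
    refine haltsWith_setVar hM ⟨?_, ?_, ?_⟩
    · rw [hZ0]
      exact hM.write_scalar (by simpa [Expr.eval] using HtLe.zero hh) 1
    · rw [write_of_ne _ _ (by omega), hk]
    · rw [write_self]
      simp [Expr.eval]
  · refine (haltsWith_forLoop Z inv hnh hnR (fun _ _ hM => hM.1) ?_ ?_ ?_ hM₁).mono
      fun M' hM' => ⟨hM'.1, hM'.2.2⟩
    · rintro i M' q hq ⟨h1, h2, h3⟩
      refine ⟨h1.write_scalar hq 5, ?_, ?_⟩
      · rw [write_of_ne _ _ (by omega), h2]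
      · rw [write_of_ne _ _ (by omega), h3]
    · intro i M' hM'
      rw [hM'.1.eval_colsExpr, hn]
    · rintro i hi M' ⟨h1, h2, h3⟩ hi'
      have hval : (Expr.add (.div (.get 3 (var 5)) (.const 2))
          (.div (.const 1) (.mul (.const 2) (var 0)))).eval M' = I 3 i / 2 + 1 / (2 * k) := by
        simp only [Expr.eval, eval_var, hi', h2, Nat.floor_natCast, h1.input 3 (by omega)]
      -- Array `4` starts at zero, so after `i` passes it holds the start point truncated to `i`
      -- coordinates.
      have hupd : Function.update (Z i) i (I 3 i / 2 + 1 / (2 * k)) = Z (i + 1) := by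
        funext l
        rcases lt_trichotomy l i with hl | rfl | hl
        · simp [hZ, startPoint, hl.ne, hl, hl.trans (Nat.lt_succ_self i)]
        · simp [hZ, startPoint]
        · simp [hZ, startPoint, hl.ne', hl.not_gt, show ¬ l < i + 1 by omega]
      refine HaltsWith.seq (mid := fun M' => Holds h I (Z (i + 1)) M' ∧ M' 5 0 = k ∧
        M' 5 1 = ∑ l ∈ range i, I 2 l * startPoint (I 3) k n l ∧ M' 5 5 = i) (by omega) hh ?_ ?_
      · refine haltsWith_assign_var h1 hi' ?_
        rw [hval]
        refine ⟨?_, ?_, ?_, ?_⟩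
        · rw [← hupd]
          exact h1.write_point (hz i hi) i
        · rw [write_point_scalar, h2]
        · rw [write_point_scalar, h3]
        · rw [write_point_scalar, hi']
      · rintro M₂ ⟨h4, h5, h6, h7⟩
        have hZi : Z (i + 1) i = startPoint (I 3) k n i := by simp [hZ, startPoint, hi]
        have hval' : (Expr.add (var 1) (.mul (.get 2 (var 5)) (.get 4 (var 5)))).eval M₂ =
            ∑ l ∈ range (i + 1), I 2 l * startPoint (I 3) k n l := by
          rw [Expr.eval, eval_var, h6, Expr.eval, eval_get_var 2 h7, eval_get_var 4 h7, h4.point,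
            h4.input 2 (by omega), sum_range_succ, hZi]
        refine haltsWith_setVar h4 ?_
        rw [hval']
        refine ⟨⟨h4.write_scalar (hv _ hi) 1, ?_, write_self _ _ _ _⟩, ?_⟩
        · rw [write_of_ne _ _ (by omega), h5]
        · rw [write_of_ne _ _ (by omega), h7]

theorem haltsWith_scaleProg {v : ℚ} (hm : I 0 0 = m)
    (hsR : halvings (2 * m / v) + 1 ≤ R) (hM : Holds h I z M) (hv : M 5 1 = v)
    (hq : ∀ r ≤ halvings (2 * m / v), HtLe (2 * m / v / 2 ^ r) h)
    (hs : ∀ r ≤ halvings (2 * m / v), HtLe (r : ℚ) h)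
    (hD : ∀ r ≤ halvings (2 * m / v), HtLe (16 ^ r) h) :
    HaltsWith h R scaleProg M fun M' => Holds h I z M' ∧ M' 5 3 = halvings (2 * m / v) ∧
      M' 5 4 = 16 ^ halvings (2 * m / v) := by
  have hh := hM.one_le
  have hR : 1 ≤ R := by omega
  set inv : ℕ → Memory → Prop := fun r M' => Holds h I z M' ∧ M' 5 2 = 2 * m / v / 2 ^ r ∧
    M' 5 3 = r ∧ M' 5 4 = 16 ^ r
  refine HaltsWith.seq (mid := fun M' => Holds h I z M' ∧ M' 5 2 = 2 * m / v / 2 ^ 0) hR hh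
    ?_ ?_
  · have hval : (Expr.div (.mul (.const 2) rowsExpr) (var 1)).eval M = 2 * m / v / 2 ^ 0 := by
      rw [Expr.eval, eval_var, hv, Expr.eval, Expr.eval, hM.eval_rowsExpr, hm, pow_zero, div_one]
    refine haltsWith_setVar hM ?_
    rw [hval]
    exact ⟨hM.write_scalar (hq 0 (Nat.zero_le _)) 2, write_self _ _ _ _⟩
  rintro M₁ ⟨h1, h2⟩
  refine HaltsWith.seq (mid := fun M' => Holds h I z M' ∧ M' 5 2 = 2 * m / v / 2 ^ 0 ∧
    M' 5 3 = (0 : ℕ)) hR hh ?_ ?_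
  · refine haltsWith_setVar h1 ⟨h1.write_scalar (HtLe.zero hh) 3, ?_, ?_⟩
    · rw [write_of_ne _ _ (by omega), h2]
    · rw [write_self, Expr.eval, Nat.cast_zero]
  rintro M₂ ⟨h3, h4, h5⟩
  refine HaltsWith.seq (mid := inv 0) hR hh ?_ ?_
  · refine haltsWith_setVar h3 ⟨h3.write_scalar (HtLe.one hh) 4, ?_, ?_, ?_⟩
    · rw [write_of_ne _ _ (by omega), h4]
    · rw [write_of_ne _ _ (by omega), h5]
    · rw [write_self, Expr.eval, pow_zero]
  intro M₃ h6
  refine (HaltsWith.loop inv hsR hh (fun _ _ hM => hM.1.htLe) ?_ ?_ h6).mono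
    fun M' hM' => ⟨hM'.1, hM'.2.2⟩
  · rintro r hr M' ⟨h7, h8, h9, h10⟩
    constructor
    · have hlt : (1 : ℚ) < 2 * m / v / 2 ^ r := by
        rw [lt_div_iff₀ (by positivity), one_mul]
        exact not_le.mp fun hle => (halvings_le_iff.mpr hle).not_gt hr
      rw [Expr.eval, eval_var, h8, Expr.eval, if_pos hlt]
      exact one_ne_zero
    · refine HaltsWith.seq (mid := fun M' => Holds h I z M' ∧ M' 5 2 = 2 * m / v / 2 ^ (r + 1) ∧
        M' 5 3 = r ∧ M' 5 4 = 16 ^ r) hR hh ?_ ?_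
      · have hval : (Expr.div (var 2) (.const 2)).eval M' = 2 * m / v / 2 ^ (r + 1) := by
          rw [Expr.eval, eval_var, h8, Expr.eval, pow_succ, div_mul_eq_div_div]
        refine haltsWith_setVar h7 ?_
        rw [hval]
        refine ⟨h7.write_scalar (hq _ hr) 2, write_self _ _ _ _, ?_, ?_⟩
        · rw [write_of_ne _ _ (by omega), h9]
        · rw [write_of_ne _ _ (by omega), h10]
      rintro M₄ ⟨h11, h12, h13, h14⟩
      refine HaltsWith.seq (mid := fun M' => Holds h I z M' ∧ M' 5 2 = 2 * m / v / 2 ^ (r + 1) ∧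
        M' 5 3 = (r + 1 : ℕ) ∧ M' 5 4 = 16 ^ r) hR hh ?_ ?_
      · have hval : (Expr.add (var 3) (.const 1)).eval M₄ = (r + 1 : ℕ) := by
          rw [Expr.eval, eval_var, h13, Expr.eval, Nat.cast_succ]
        refine haltsWith_setVar h11 ?_
        rw [hval]
        refine ⟨h11.write_scalar (hs _ hr) 3, ?_, write_self _ _ _ _, ?_⟩
        · rw [write_of_ne _ _ (by omega), h12]
        · rw [write_of_ne _ _ (by omega), h14]
      rintro M₅ ⟨h15, h16, h17, h18⟩
      have hval : (Expr.mul (var 4) (.const 16)).eval M₅ = 16 ^ (r + 1) := by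
        rw [Expr.eval, eval_var, h18, Expr.eval, pow_succ]
      refine haltsWith_setVar h15 ?_
      rw [hval]
      refine ⟨h15.write_scalar (hD _ hr) 4, ?_, ?_, write_self _ _ _ _⟩
      · rw [write_of_ne _ _ (by omega), h16]
      · rw [write_of_ne _ _ (by omega), h17]
  · rintro M' ⟨h7, h8, h9, h10⟩
    have hle : ¬ (1 : ℚ) < 2 * m / v / 2 ^ halvings (2 * m / v) := by
      rw [not_lt, div_le_iff₀ (by positivity), one_mul]
      exact halvings_le_iff.mp le_rfl
    rw [Expr.eval, eval_var, h8, Expr.eval, if_neg hle]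

/-- Rounding only ever writes `0` or `1`, so the point does not grow in height. -/
theorem htLe_roundSeq {a : ℕ → ℕ → ℚ} {c : ℕ → ℚ} {s : ℕ} (hz : ∀ l, HtLe (z l) h) (i l : ℕ) :
    HtLe (roundSeq a c m n s z i l) h := by
  induction i generalizing l with
  | zero => exact hz l
  | succ i ih =>
    rw [roundSeq, Function.update_apply]
    split_ifs
    exacts [HtLe.one (hz 0).one_le, HtLe.zero (hz 0).one_le, ih l]

/-- The objective value of the start point. -/
def startValue (I : Memory) (n : ℕ) : ℚ :=
  ∑ l ∈ range n, I 2 l * startPoint (I 3) (∑ l ∈ range n, I 1 l) n l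

/-- Each level of summation or multiplication costs one factor `b`: the start point has height of
order `b ^ 2`, the quotient `2 m / v` order `b ^ 3`, row weights order `b ^ 4`, and congestions
order `b ^ 5`. Feasibility is not needed, since division by zero returns `0`. -/
theorem haltsWith_program {b : ℕ} (hm : I 0 0 = m) (hn : I 0 1 = n) (hz : I 4 = fun _ => 0)
    (hI : ∀ a l, HtLe (I a l) b) (hmb : m + 1 ≤ b) (hnb : n + 1 ≤ b) :
    HaltsWith (100 * b ^ 5) (21 * b ^ 3) program I fun M' =>
      M' 4 = roundSeq (fun j l => I 1 (j * n + l)) (I 2) m n (halvings (2 * m / startValue I n))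
        (startPoint (I 3) (∑ l ∈ range n, I 1 l) n) n := by
  have hb : 1 ≤ b := by omega
  have hb2 : b ≤ b ^ 2 := by nlinarith
  have hb3 : b ^ 2 ≤ b ^ 3 := Nat.pow_le_pow_right hb (by norm_num)
  have hb4 : b ^ 3 ≤ b ^ 4 := Nat.pow_le_pow_right hb (by norm_num)
  have hb5 : b ^ 4 ≤ b ^ 5 := Nat.pow_le_pow_right hb (by norm_num)
  have hpow : 100 * b ^ 5 ≤ 2 ^ (100 * b ^ 5) := Nat.lt_two_pow_self.le
  have hmh : m ≤ 2 ^ (100 * b ^ 5) := by omega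
  have hnh : n ≤ 2 ^ (100 * b ^ 5) := by omega
  have hmR : m + 1 ≤ 21 * b ^ 3 := by omega
  have hnR : n + 1 ≤ 21 * b ^ 3 := by omega
  have hk' : ∀ i ≤ n, HtLe (∑ l ∈ range i, I 1 l) (b ^ 2) := fun i hi =>
    (HtLe.sum_range hb fun l _ => hI 1 l).mono (by nlinarith)
  set k := ∑ l ∈ range n, I 1 l with hk
  have h2 : HtLe 2 1 := by simpa using HtLe.natCast (n := 2) le_rfl (by norm_num)
  have hz1 : ∀ l, HtLe (I 3 l / 2 + 1 / (2 * k)) (8 * b ^ 2) := fun l =>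
    (((hI 3 l).div h2).add ((HtLe.one le_rfl).div (h2.mul (hk' n le_rfl)))).mono (by omega)
  set z := startPoint (I 3) k n with hzdef
  have hz2 : ∀ l, HtLe (z l) (8 * b ^ 2) := by
    intro l
    rw [hzdef, startPoint]
    split_ifs
    exacts [hz1 l, HtLe.zero (by omega)]
  have hv : ∀ i ≤ n, HtLe (∑ l ∈ range i, I 2 l * z l) (9 * b ^ 3) := fun i hi =>
    (HtLe.sum_range (h := 9 * b ^ 2) (by omega) fun l _ =>
      ((hI 2 l).mul (hz2 l)).mono (by omega)).mono (by
        rw [show 9 * b ^ 3 = b * (9 * b ^ 2) by ring]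
        exact Nat.mul_le_mul_right _ (by omega))
  have hvdef : startValue I n = ∑ l ∈ range n, I 2 l * z l := rfl
  have hq0 : HtLe (2 * m / startValue I n) (20 * b ^ 3) := by
    rw [hvdef, ← hm]
    exact ((h2.mul (hI 0 0)).div (hv n le_rfl)).mono (by omega)
  set s := halvings (2 * m / startValue I n) with hs
  -- A quotient of height `H` is at most `2 ^ H`, so at most `H` halvings are made.
  have hs20 : s ≤ 20 * b ^ 3 := halvings_le_iff.mpr ((le_abs_self _).trans hq0.abs_le)
  have hsh : ∀ r ≤ s, HtLe (r : ℚ) (20 * b ^ 3) := fun r hr =>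
    HtLe.natCast (by omega) ((hr.trans hs20).trans Nat.lt_two_pow_self.le)
  have h16 : HtLe 16 4 := by
    simpa using HtLe.natCast (n := 16) (h := 4) (by norm_num) (by norm_num)
  have hw : ∀ i j l, l ≤ n → HtLe (rowWeight (fun j l => I 1 (j * n + l)) l s
      (Function.update (roundSeq (fun j l => I 1 (j * n + l)) (I 2) m n s z i) i 0) j)
        (30 * b ^ 4) := by
    intro i j l hl
    refine (HtLe.prod_range (h := 30 * b ^ 3) (by omega) fun l' _ => ?_).mono (by
      rw [show 30 * b ^ 4 = b * (30 * b ^ 3) by ring]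
      exact Nat.mul_le_mul_right _ (by omega))
    have hu : HtLe (Function.update (roundSeq (fun j l => I 1 (j * n + l)) (I 2) m n s z i) i 0 l')
        (8 * b ^ 2) := by
      rw [Function.update_apply]
      split_ifs
      exacts [HtLe.zero (by omega), htLe_roundSeq hz2 i l']
    exact ((HtLe.one le_rfl).add ((hsh s le_rfl).mul ((hI 1 _).mul hu))).mono (by omega)
  have hM : Holds (100 * b ^ 5) I (fun _ => 0) I :=
    ⟨fun _ _ => rfl, hz, fun a l => (hI a l).mono (by omega)⟩
  refine HaltsWith.seq (by omega) hM.one_le (haltsWith_countProg hn hnh hnR hM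
    fun i hi => (hk' i hi).mono (by omega)) ?_
  rintro M₁ ⟨hM₁, hkM⟩
  refine HaltsWith.seq (by omega) hM.one_le (haltsWith_initProg hn hnh hnR hM₁ hkM
    (fun l _ => (hz1 l).mono (by omega)) fun i hi => (hv i hi).mono (by omega)) ?_
  rintro M₂ ⟨hM₂, hvM⟩
  refine HaltsWith.seq (by omega) hM.one_le (haltsWith_scaleProg (v := startValue I n) hm
    ((Nat.succ_le_succ hs20).trans (by omega)) hM₂ hvM
    (fun r hr => (hq0.div (h2.pow r)).mono (by
      have : r ≤ 20 * b ^ 3 := le_trans hr hs20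
      omega))
    (fun r hr => (hsh r hr).mono (by omega))
    fun r hr => (h16.pow r).mono (by
      have : r ≤ 20 * b ^ 3 := le_trans hr hs20
      omega)) ?_
  rintro M₃ ⟨hM₃, hsM, hDM⟩
  refine haltsWith_roundProg hm hn hmh hnh hmR hnR hM₃ hsM hDM
    (fun i _ j _ l hl => (hw i j l hl).mono (by omega)) fun i _ j hj => ?_
  refine (HtLe.sum_range (h := 31 * b ^ 4) (by omega) fun j' _ =>
    ((hI 1 _).mul (hw i j' n le_rfl)).mono (by omega)).mono ?_
  calc (j + 1) * (31 * b ^ 4) ≤ b * (31 * b ^ 4) := Nat.mul_le_mul_right _ (by omega)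
    _ = 31 * b ^ 5 := by ring
    _ ≤ 100 * b ^ 5 := by omega

end RoundingProgram

/-! ### The main theorem -/

open RoundingProgram in
/-- Every matrix with `k` ones in each row admits a good rounding. -/
theorem isGoodRounding_roundSeq {m n k : ℕ} {p : ℝ} (hk : 1 ≤ k) (hkn : k ≤ n) (hp : 0 < p)
    (hload : Real.exp 1 < load m n k p + Real.log m) {A : BoolMat m n}
    (hA : ∀ i, A i ∈ rowsWith n k) {c x : Fin n → ℝ} (hcx : Feasible A p c x)
    {a : ℕ → ℕ → ℝ} {c' x' : ℕ → ℝ} (ha : ∀ j l, a j l = 0 ∨ a j l = 1)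
    (haA : ∀ (j : Fin m) (l : Fin n), a j l = A.toReal j l)
    (hc' : ∀ l : Fin n, c' l = c l) (hx' : ∀ l : Fin n, x' l = x l) {v : ℝ} {s : ℕ}
    (hv : v = ∑ l ∈ Finset.range n, c' l * startPoint x' (k : ℝ) n l)
    (hs : ∀ r, s ≤ r ↔ 2 * (m : ℝ) / v ≤ 2 ^ r) :
    IsGoodRounding A (600 * errorBound m n k p) (1 / 4) c x
      (fun l => roundSeq a c' m n s (startPoint x' (k : ℝ) n) n l) := by
  obtain ⟨hc, hx, hAx⟩ := hcx
  set z := startPoint x' (k : ℝ) n with hz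
  have hk' : (1 : ℝ) ≤ k := by exact_mod_cast hk
  have hn' : (0 : ℝ) < n := by exact_mod_cast (by omega : 0 < n)
  have hzl : ∀ l : Fin n, z l = x l / 2 + 1 / (2 * k) := fun l => by
    simp [hz, startPoint, hx']
  have hk2 : (1 : ℝ) / (2 * k) ≤ 1 / 2 := one_div_le_one_div_of_le (by norm_num) (by linarith)
  have hz01 : ∀ l, 0 ≤ z l ∧ z l ≤ 1 := by
    intro l
    by_cases hl : l < n
    · rw [hzl ⟨l, hl⟩]
      have := hx ⟨l, hl⟩
      have : (0 : ℝ) ≤ 1 / (2 * k) := by positivity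
      constructor <;> linarith
    · simp [hz, startPoint, hl]
  have ha0 : ∀ j l, 0 ≤ a j l := fun j l => by rcases ha j l with h | h <;> simp [h]
  have hrow : ∀ j : Fin m, ∑ l, A.toReal j l = k := by
    intro j
    have := hA j
    rw [rowsWith, Set.mem_ofPred_eq] at this
    rw [← this, Finset.card_filter]
    push_cast
    rfl
  -- One half comes from `A x ≤ 1`, the other from `k` ones times `1 / (2 k)`.
  have haz : ∀ j < m, ∑ l ∈ Finset.range n, a j l * z l ≤ 1 := by
    intro j hj
    have h1 := hAx ⟨j, hj⟩
    rw [Matrix.mulVec, dotProduct] at h1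
    have h2 := hrow ⟨j, hj⟩
    rw [Finset.sum_range]
    calc ∑ l : Fin n, a j l * z l
        = (∑ l, A.toReal ⟨j, hj⟩ l * x l) / 2 + (∑ l, A.toReal ⟨j, hj⟩ l) * (1 / (2 * k)) := by
          rw [Finset.sum_div, Finset.sum_mul, ← Finset.sum_add_distrib]
          refine Finset.sum_congr rfl fun l _ => ?_
          rw [hzl, ← haA ⟨j, hj⟩ l]
          ring
      _ ≤ 1 := by
          rw [h2]
          have : (k : ℝ) * (1 / (2 * k)) = 1 / 2 := by field_simp
          linarith
  have hcsum : (n : ℝ) / p ≤ ∑ l, c l := by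
    calc (n : ℝ) / p = ∑ l : Fin n, 1 / p := by simp [div_eq_mul_inv]
      _ ≤ ∑ l, c l := Finset.sum_le_sum fun l _ => (hc l).1
  have hveq : v = (c ⬝ᵥ x) / 2 + (∑ l, c l) * (1 / (2 * k)) := by
    rw [hv, Finset.sum_range, dotProduct, Finset.sum_div, Finset.sum_mul,
      ← Finset.sum_add_distrib]
    refine Finset.sum_congr rfl fun l _ => ?_
    rw [hc', hzl]
    ring
  have hcpos : ∀ l, 0 < c l := fun l => (by positivity : 0 < 1 / p).trans_le (hc l).1
  have hcx0 : 0 ≤ c ⬝ᵥ x := Finset.sum_nonneg fun l _ => mul_nonneg (hcpos l).le (hx l).1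
  -- This is the purpose of the constant part of the start point: `v` cannot be small even if the
  -- optimum is.
  have hvlow : (n : ℝ) / p * (1 / (2 * k)) ≤ v := by
    have := mul_le_mul_of_nonneg_right hcsum (by positivity : (0 : ℝ) ≤ 1 / (2 * k))
    linarith
  have hcxv : c ⬝ᵥ x ≤ 2 * v := by
    have : 0 ≤ (∑ l, c l) * (1 / (2 * (k : ℝ))) :=
      mul_nonneg (Finset.sum_nonneg fun l _ => (hcpos l).le) (by positivity)
    linarith
  have hvpos : 0 < v := lt_of_lt_of_le (by positivity) hvlow
  have hs1 : 2 * (m : ℝ) ≤ 2 ^ s * v := (div_le_iff₀ hvpos).mp ((hs s).mp le_rfl)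
  have hs2 : 1 ≤ s → (2 : ℝ) ^ s < 8 * ((m : ℝ) * k * p / n) := by
    intro hs0
    obtain ⟨r, rfl⟩ := Nat.exists_eq_add_of_le' hs0
    -- Minimality of `s = r + 1`.
    have h1 : (2 : ℝ) ^ r * v < 2 * m :=
      (lt_div_iff₀ hvpos).mp (not_le.mp fun h => absurd ((hs r).mpr h) (by omega))
    have h2 := (mul_le_mul_of_nonneg_left hvlow (by positivity : (0 : ℝ) ≤ 2 ^ r)).trans_lt h1
    rw [← mul_div_assoc, lt_div_iff₀ hn', pow_succ]
    have h3 : (2 : ℝ) ^ r * (n / p * (1 / (2 * k))) = 2 ^ r * n / (2 * k * p) := by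
      field_simp
    rw [h3, div_lt_iff₀ (by positivity)] at h2
    linarith
  refine ⟨fun l => roundSeq_eq_zero_or_one l.2, ?_, ?_⟩
  · have heb : 0 ≤ 600 * errorBound m n k p := mul_nonneg (by norm_num) (le_max_left _ _)
    rw [pi_norm_le_iff_of_nonneg heb]
    intro j
    have h1 : (A.toReal *ᵥ fun l : Fin n => roundSeq a c' m n s z n l) j =
        rowLoad (a j) (roundSeq a c' m n s z n) n := by
      rw [rowLoad_eq_sum (ha j) fun l hl => roundSeq_eq_zero_or_one hl, Matrix.mulVec, dotProduct,
        Finset.sum_range]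
      exact Finset.sum_congr rfl fun l _ => by rw [haA]
    rw [h1, Real.norm_of_nonneg (Nat.cast_nonneg _)]
    refine load_le_errorBound hload hs2 (rowLoad_roundSeq ha hz01 (fun l hl => ?_) j.2)
    rw [hc' ⟨l, hl⟩]
    exact (hc _).2
  · have h1 := value_le_two_mul_roundSeq (c := c') ha0 hz01 haz (by rwa [← hv])
    rw [← hv, Finset.sum_range] at h1
    have h2 : (c ⬝ᵥ fun l : Fin n => roundSeq a c' m n s z n l) =
        ∑ l : Fin n, c' l * roundSeq a c' m n s z n l :=
      Finset.sum_congr rfl fun l _ => by rw [hc']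
    rw [h2]
    linarith

open RoundingProgram in
theorem exists_isGoodRounding {m n k : ℕ} {p : ℝ} (hk : 1 ≤ k) (hkn : k ≤ n) (hp : 0 < p)
    (hload : Real.exp 1 < load m n k p + Real.log m) {A : BoolMat m n}
    (hA : ∀ i, A i ∈ rowsWith n k) {c x : Fin n → ℝ} (hcx : Feasible A p c x) :
    ∃ y, IsGoodRounding A (600 * errorBound m n k p) (1 / 4) c x y := by
  refine ⟨_, isGoodRounding_roundSeq hk hkn hp hload hA hcx
    (a := fun j l => if h : j < m ∧ l < n then A.toReal ⟨j, h.1⟩ ⟨l, h.2⟩ else 0)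
    (c' := fun l => if h : l < n then c ⟨l, h⟩ else 0)
    (x' := fun l => if h : l < n then x ⟨l, h⟩ else 0) (fun j l => ?_) (fun j l => by simp)
    (fun l => by simp) (fun l => by simp) rfl fun r => halvings_le_iff⟩
  split_ifs with h
  · simp only [BoolMat.toReal, Matrix.of_apply]
    split_ifs <;> simp
  · exact Or.inl rfl

/-! ### The program on encoded inputs -/

theorem bitLength_le_inputLength {m n : ℕ} (A : BoolMat m n) (c x : Fin n → ℚ) (j : Fin n) :
    bitLength (c j) ≤ inputLength A c x ∧ bitLength (x j) ≤ inputLength A c x := by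
  have h1 : bitLength (c j) ≤ ∑ j, bitLength (c j) :=
    Finset.single_le_sum (f := fun j => bitLength (c j)) (fun _ _ => Nat.zero_le _)
      (Finset.mem_univ j)
  have h2 : bitLength (x j) ≤ ∑ j, bitLength (x j) :=
    Finset.single_le_sum (f := fun j => bitLength (x j)) (fun _ _ => Nat.zero_le _)
      (Finset.mem_univ j)
  unfold inputLength
  omega

theorem htLe_inputMemory {m n : ℕ} (A : BoolMat m n) (c x : Fin n → ℚ) (b l : ℕ) :
    HtLe (inputMemory A c x b l) (inputLength A c x + 1) := by
  have h1 : 1 ≤ inputLength A c x + 1 := by omega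
  have hpow : inputLength A c x + 1 ≤ 2 ^ (inputLength A c x + 1) := Nat.lt_two_pow_self.le
  have hm : m ≤ inputLength A c x := by unfold inputLength; omega
  have hn : n ≤ inputLength A c x := by unfold inputLength; omega
  unfold inputMemory
  split
  · split_ifs
    exacts [HtLe.natCast h1 (by omega), HtLe.natCast h1 (by omega), HtLe.zero h1]
  · split_ifs
    exacts [HtLe.one h1, HtLe.zero h1, HtLe.zero h1]
  · split_ifs with h
    exacts [HtLe.of_bitLength_le ((bitLength_le_inputLength A c x ⟨l, h⟩).1.trans (by omega)),
      HtLe.zero h1]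
  · split_ifs with h
    exacts [HtLe.of_bitLength_le ((bitLength_le_inputLength A c x ⟨l, h⟩).2.trans (by omega)),
      HtLe.zero h1]
  · exact HtLe.zero h1

theorem inputMemory_entry {m n : ℕ} (A : BoolMat m n) (c x : Fin n → ℚ) (j : Fin m) (l : Fin n) :
    inputMemory A c x 1 (j * n + l) = if A j l then 1 else 0 := by
  have hval : (finProdFinEquiv (j, l) : ℕ) = j * n + l := by
    rw [finProdFinEquiv_apply_val]
    ring
  have hlt : (j : ℕ) * n + l < m * n := hval ▸ (finProdFinEquiv (j, l)).2
  have heq : (⟨j * n + l, hlt⟩ : Fin (m * n)) = finProdFinEquiv (j, l) := Fin.ext hval.symm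
  simp only [inputMemory, hlt, dif_pos, heq, Equiv.symm_apply_apply]

theorem inputMemory_entry_eq_zero_or_one {m n : ℕ} (A : BoolMat m n) (c x : Fin n → ℚ) (l : ℕ) :
    inputMemory A c x 1 l = 0 ∨ inputMemory A c x 1 l = 1 := by
  simp only [inputMemory]
  split_ifs <;> simp

open RoundingProgram in
/-- The vector computed by the program. -/
def programOutput {m n : ℕ} (A : BoolMat m n) (c x : Fin n → ℚ) (j : Fin n) : ℚ :=
  roundSeq (fun j l => inputMemory A c x 1 (j * n + l)) (inputMemory A c x 2) m n
    (halvings (2 * m / startValue (inputMemory A c x) n))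
    (startPoint (inputMemory A c x 3) (∑ l ∈ Finset.range n, inputMemory A c x 1 l) n) n j

open RoundingProgram in
theorem outputs_program {m n : ℕ} (A : BoolMat m n) (c x : Fin n → ℚ) (ω : ℕ → Bool) :
    ∃ t, Outputs program ω A c x t (programOutput A c x) ∧
      t ≤ program.weight * (100 * (inputLength A c x + 1) ^ 5) *
        (21 * (inputLength A c x + 1) ^ 3) ^ program.depth := by
  obtain ⟨t, M, hrun, ht, hM⟩ := haltsWith_program (I := inputMemory A c x) (m := m) (n := n)
    (by simp [inputMemory]) (by simp [inputMemory]) rfl (htLe_inputMemory A c x)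
    (by unfold inputLength; omega) (by unfold inputLength; omega) ω 0
  exact ⟨t, ⟨⟨M, 0⟩, hrun, fun j => congrFun hM j⟩, ht⟩

open RoundingProgram in
theorem runsInPolyTime_program : RunsInPolyTime program := by
  refine ⟨Polynomial.C program.weight * (100 * (Polynomial.X + 1) ^ 5) *
    (21 * (Polynomial.X + 1) ^ 3) ^ program.depth, fun m n A c x ω => ?_⟩
  obtain ⟨t, hout, ht⟩ := outputs_program A c x ω
  refine ⟨t, _, hout, ht.trans (le_of_eq ?_)⟩
  simp

open RoundingProgram in
theorem isGoodRounding_programOutput {m n k : ℕ} {p : ℝ} (hk : 1 ≤ k) (hkn : k ≤ n) (hp : 0 < p)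
    (hload : Real.exp 1 < load m n k p + Real.log m) {A : BoolMat m n}
    (hA : ∀ i, A i ∈ rowsWith n k) {c x : Fin n → ℚ}
    (hcx : Feasible A p (fun j => (c j : ℝ)) (fun j => (x j : ℝ))) :
    IsGoodRounding A (600 * errorBound m n k p) (1 / 4) (fun j => (c j : ℝ)) (fun j => (x j : ℝ))
      (fun j => (programOutput A c x j : ℝ)) := by
  -- The program reads `k` off the first row, so there must be one; for `m = 0` both terms of
  -- `hload` vanish.
  have hm : 0 < m := by
    rcases Nat.eq_zero_or_pos m with rfl | hm
    · simp only [load, Nat.cast_zero, Real.log_zero, mul_zero, zero_div, add_zero] at hload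
      exact absurd hload (Real.exp_pos 1).not_gt
    · exact hm
  have hcount : ∑ l ∈ Finset.range n, inputMemory A c x 1 l = k := by
    have h1 := hA ⟨0, hm⟩
    rw [rowsWith, Set.mem_ofPred_eq] at h1
    rw [Finset.sum_range, ← h1, Finset.card_filter]
    push_cast
    refine Finset.sum_congr rfl fun l _ => ?_
    simpa using inputMemory_entry A c x ⟨0, hm⟩ l
  have hstart : ∀ l, ((startPoint (inputMemory A c x 3) (k : ℚ) n l : ℚ) : ℝ) =
      startPoint (fun l => (inputMemory A c x 3 l : ℝ)) (k : ℝ) n l := by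
    intro l
    unfold startPoint
    split_ifs
    · push_cast
      rfl
    · simp
  have hfun : (fun j => (programOutput A c x j : ℝ)) = fun j : Fin n =>
      roundSeq (fun j l => (inputMemory A c x 1 (j * n + l) : ℝ))
        (fun l => (inputMemory A c x 2 l : ℝ)) m n
        (halvings (2 * m / startValue (inputMemory A c x) n))
        (startPoint (fun l => (inputMemory A c x 3 l : ℝ)) (k : ℝ) n) n j := by
    funext j
    rw [programOutput, ratCast_roundSeq, hcount]
    simp only [hstart]
  rw [hfun]
  refine isGoodRounding_roundSeq hk hkn hp hload hA hcx (fun j l => ?_) (fun j l => ?_)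
    (fun l => ?_) (fun l => ?_) (v := (startValue (inputMemory A c x) n : ℝ)) ?_ fun r => ?_
  · rcases inputMemory_entry_eq_zero_or_one A c x (j * n + l) with h | h <;> simp [h]
  · rw [inputMemory_entry]
    simp only [BoolMat.toReal, Matrix.of_apply]
    split_ifs <;> simp
  · simp [inputMemory]
  · simp [inputMemory]
  · rw [startValue, hcount]
    push_cast
    simp only [hstart]
  · rw [halvings_le_iff, ← Rat.cast_le (K := ℝ)]
    push_cast
    rfl

/-! ### Probability -/

theorem randomMatrix_rowsWith {m n k : ℕ} (hkn : k ≤ n) :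
    IsProbabilityMeasure (randomMatrix m n k) ∧
      randomMatrix m n k {A | ∀ i, A i ∈ rowsWith n k} = 1 := by
  have hne : (rowsWith n k).Nonempty := by
    obtain ⟨s, -, hs⟩ := Finset.exists_subset_card_eq
      (show k ≤ (Finset.univ : Finset (Fin n)).card by simpa using hkn)
    exact ⟨fun j => decide (j ∈ s), by simp [rowsWith, hs]⟩
  have hfin : (rowsWith n k).Finite := Set.toFinite _
  have hprob : IsProbabilityMeasure (uniformOn (rowsWith n k)) :=
    isProbabilityMeasure_uniformOn hfin hne
  refine ⟨by unfold randomMatrix; infer_instance, ?_⟩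
  have hset : {A : BoolMat m n | ∀ i, A i ∈ rowsWith n k} =
      Set.univ.pi fun _ => rowsWith n k := by
    ext A
    simp
  rw [randomMatrix, hset, Measure.pi_pi]
  simp [uniformOn_self hfin hne]

/-- Monotonicity of the measure is enough, so the event `t` of good outcomes need not be shown
measurable. -/
theorem one_sub_le_measureReal_of_subset {Ω : Type*} [MeasurableSpace Ω] {μ : Measure Ω}
    [IsProbabilityMeasure μ] {s t : Set Ω} (hs : μ s = 1) (hst : s ⊆ t) (m : ℕ) :
    1 - 1 / (m : ℝ) ≤ μ.real t := by
  have h1 : μ.real s = 1 := by rw [measureReal_def, hs, ENNReal.toReal_one]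
  have h2 : (0 : ℝ) ≤ 1 / m := by positivity
  have h3 := measureReal_mono (μ := μ) hst
  linarith

theorem mainTheorem1 :
    ∃ C : ℝ, 0 < C ∧ ∃ α : ℝ, 0 < α ∧
      -- existence of the rounding, for real data
      (∀ (m n k : ℕ) (p : ℝ), 1 ≤ k → k ≤ n → 0 < p →
        Real.exp 1 < load m n k p + Real.log m →
        1 - 1 / (m : ℝ) ≤ (randomMatrix m n k).real
          {A | ∀ c x : Fin n → ℝ, Feasible A p c x →
            ∃ y : Fin n → ℝ, IsGoodRounding A (C * errorBound m n k p) α c x y}) ∧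
      -- computation of the rounding in randomized polynomial time, for rational data
      ∃ P : Prog, RunsInPolyTime P ∧
        ∀ (m n k : ℕ) (p : ℝ), 1 ≤ k → k ≤ n → 0 < p →
          Real.exp 1 < load m n k p + Real.log m →
          ∀ c x : BoolMat m n → Fin n → ℚ,
            (∀ A : BoolMat m n, (∀ i, A i ∈ rowsWith n k) →
              Feasible A p (fun j => (c A j : ℝ)) (fun j => (x A j : ℝ))) →
            1 - 1 / (m : ℝ) ≤ ((randomMatrix m n k).prod fairCoins).real
              {z | ∃ (t : ℕ) (y : Fin n → ℚ), Outputs P z.2 z.1 (c z.1) (x z.1) t y ∧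
                IsGoodRounding z.1 (C * errorBound m n k p) α
                  (fun j => (c z.1 j : ℝ)) (fun j => (x z.1 j : ℝ)) (fun j => (y j : ℝ))} := by
  refine ⟨600, by norm_num, 1 / 4, by norm_num, fun m n k p hk hkn hp hload => ?_,
    RoundingProgram.program, runsInPolyTime_program, fun m n k p hk hkn hp hload c x hcx => ?_⟩
  · obtain ⟨hprob, hone⟩ := randomMatrix_rowsWith (m := m) hkn
    refine one_sub_le_measureReal_of_subset hone ?_ m
    intro A hA c x hcx
    exact exists_isGoodRounding hk hkn hp hload hA hcx
  · obtain ⟨hprob, hone⟩ := randomMatrix_rowsWith (m := m) hkn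
    have hcoin : IsProbabilityMeasure (uniformOn (Set.univ : Set Bool)) :=
      isProbabilityMeasure_uniformOn Set.finite_univ Set.univ_nonempty
    have hfair : IsProbabilityMeasure fairCoins := by unfold fairCoins; infer_instance
    have hprod : ((randomMatrix m n k).prod fairCoins)
        ({A | ∀ i, A i ∈ rowsWith n k} ×ˢ Set.univ) = 1 := by
      rw [Measure.prod_prod, hone, measure_univ, one_mul]
    refine one_sub_le_measureReal_of_subset hprod ?_ m
    rintro ⟨A, ω⟩ ⟨hA, -⟩
    obtain ⟨t, hout, -⟩ := outputs_program A (c A) (x A) ω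
    exact ⟨t, _, hout, isGoodRounding_programOutput hk hkn hp hload hA (hcx A hA)⟩
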